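/- Let $(M,h)$ be a closed Riemannian surface with a spin structure and complex spinor bundle $\Sigma M$, let $(N,g)$ be a closed Riemannian $n$-manifold and $\iota\colon N\to\mathbb R^q$ a smooth isometric embedding. Let $\phi\colon M\to N$ and $\psi\in\Gamma(\Sigma M\otimes\phi^{-1}TN)$ be smooth. Near a point $x\in M$ let $\{e_\alpha\}$ be a local oriented orthonormal frame of $TM$ belonging to the spin structure, and let $y^1,\dots,y^n$ be local coordinates of $N$ near $\phi(x)$; write $\psi=\psi^i\otimes\partial_{y^i}$ and $\nabla\phi^l\cdot\chi=d\phi^l(e_\alpha)\,e_\alpha\cdot\chi$. Repeated indices are summed, and $\langle\cdot,\cdot\rangle$ on spinors is the Hermitian product, complex linear in the second slot. The curvature convention is $R^m{}_{lij}\partial_{y^m}=R^N(\partial_{y^i},\partial_{y^j})\partial_{y^l}$ with $R^N(X,Y)=\nabla_X\nabla_Y-\nabla_Y\nabla_X-\nabla_{[X,Y]}$, and $R_{ijkl}=g_{im}R^m{}_{jkl}$. The Euler–Lagrange equations for Dirac-harmonic maps with curvature term (those of $\frac12\int_M|d\phi|^2+\langle\psi,\slashed D\psi\rangle-\frac16R_{ijkl}\langle\psi^i,\psi^k\rangle\langle\psi^j,\psi^l\rangle$)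 are, with the tension field $\tau(\phi)$ and the twisted Dirac operator $\slashed D$, $$\tau^m(\phi)=\tfrac12R^m{}_{lij}\langle\psi^i,\nabla\phi^l\cdot\psi^j\rangle-\tfrac1{12}g^{mp}(\nabla_pR_{ijkl})\langle\psi^i,\psi^k\rangle\langle\psi^j,\psi^l\rangle,\qquad(1)$$ $$(\slashed D\psi)^m=\tfrac13R^m{}_{jkl}\langle\psi^j,\psi^l\rangle\psi^k.\qquad(2)$$ Let $\mathrm{I\!I}$ be the second fundamental form of $N$ in $\mathbb R^q$ (the normal part of the Euclidean derivative), $\nabla\mathrm{I\!I}$ its covariant derivative with respect to the normal connection and the Levi-Civita connection, and $P$ the shape operator, $\langle P(\xi,X),Y\rangle=\langle\mathrm{I\!I}(X,Y),\xi\rangle$ for normal $\xi$ and tangent $X,Y$. Regard $\phi$ as an $\mathbb R^q$-valued map and $\psi$ as the $q$-tuple of spinors $(\mathrm{id}\otimes d\iota)\psi$, let $\slashed\partial$ be the Dirac operator of $\Sigma M$ acting componentwise, and let $\Delta=-\operatorname{div}\operatorname{grad}$. Then, at every point of $M$, (1) is equivalent to $$-\Delta\phi=\mathrm{I\!I}(d\phi,d\phi)+P(\mathrm{I\!I}(e_\alpha\cdot\psi,d\phi(e_\alpha)),\psi)-G(\psi),\qquad(1')$$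 and (2) is equivalent to $$\slashed\partial\psi=\mathrm{I\!I}(d\phi(e_\alpha),e_\alpha\cdot\psi)+F(\psi,\psi)\psi.\qquad(2')$$ Here $\mathrm{I\!I}(d\phi,d\phi)=\mathrm{I\!I}(d\phi(e_\alpha),d\phi(e_\alpha))$, $\mathrm{I\!I}(d\phi(e_\alpha),e_\alpha\cdot\psi)=\nabla\phi^i\cdot\psi^j\otimes\mathrm{I\!I}(\partial_{y^i},\partial_{y^j})$, $$P(\mathrm{I\!I}(e_\alpha\cdot\psi,d\phi(e_\alpha)),\psi)=\operatorname{Re}\langle\psi^i,\nabla\phi^l\cdot\psi^j\rangle\,P(\mathrm{I\!I}(\partial_{y^j},\partial_{y^l}),\partial_{y^i}),$$ $$G(\psi)=\tfrac16\,g^{mp}\big(\langle\nabla_p\mathrm{I\!I}(\partial_{y^i},\partial_{y^k}),\mathrm{I\!I}(\partial_{y^j},\partial_{y^l})\rangle-\langle\nabla_p\mathrm{I\!I}(\partial_{y^i},\partial_{y^l}),\mathrm{I\!I}(\partial_{y^j},\partial_{y^k})\rangle\big)\langle\psi^i,\psi^k\rangle\langle\psi^j,\psi^l\rangle\,\partial_{y^m},$$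 $$F(\psi,\psi)\psi=\tfrac13\langle\psi^j,\psi^l\rangle\psi^k\otimes\big(P(\mathrm{I\!I}(\partial_{y^l},\partial_{y^j}),\partial_{y^k})-P(\mathrm{I\!I}(\partial_{y^k},\partial_{y^j}),\partial_{y^l})\big).$$ -/

import Mathlib

open scoped Manifold ContDiff TensorProduct InnerProductSpace

noncomputable section

namespace DiracHarmonic

/-! ### The spin representation in dimension two -/

/-- The space of complex spinors in dimension two. -/
abbrev Spinor : Type := EuclideanSpace ℂ (Fin 2)

/-- Clifford matrices of the standard basis of `ℝ²`; they are skew-Hermitian and satisfy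
`γ α * γ β + γ β * γ α = -2 δ_{αβ}`. -/
def gammaMatrix : Fin 2 → Matrix (Fin 2) (Fin 2) ℂ :=
  ![!![0, -1; 1, 0], !![0, Complex.I; Complex.I, 0]]

/-- Clifford multiplication by the `α`-th standard basis vector of `ℝ²`. -/
def cliff (α : Fin 2) : Spinor →ₗ[ℂ] Spinor := Matrix.toEuclideanLin (gammaMatrix α)

/-- The spin representation of `Spin(2) = {z ∈ ℂ : |z| = 1}`: the unit complex number
`cos θ + i sin θ` is the element `cos θ + sin θ E₁E₂` of the Clifford algebra. -/
def spinRep (t : Circle) : Spinor →ₗ[ℂ] Spinor :=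
  ((t : ℂ).re : ℂ) • LinearMap.id + ((t : ℂ).im : ℂ) • (cliff 0 ∘ₗ cliff 1)

/-! ### Spin surfaces -/

/-- Riemannian metrics of class `C^∞` on a manifold modelled on `ℝᵈ`. -/
abbrev Metric (d : ℕ) (X : Type*) [TopologicalSpace X]
    [ChartedSpace (EuclideanSpace ℝ (Fin d)) X] [IsManifold (𝓡 d) ∞ X] :=
  Bundle.ContMDiffRiemannianMetric (𝓡 d) ∞ (EuclideanSpace ℝ (Fin d))
    (fun x : X => TangentSpace (𝓡 d) x)

section Surface

variable {M : Type*} [TopologicalSpace M] [ChartedSpace (EuclideanSpace ℝ (Fin 2)) M]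
  [IsManifold (𝓡 2) ∞ M]

/-- A spin structure on the Riemannian surface `(M, h)`, given by local data: an open cover `U a`,
smooth orthonormal frames `frame a` on `U a` that are related by `SO(2)`-valued transition functions
(so that they orient `M`), and a smooth lift `trans` of these transition functions through the
double cover `Spin(2) → SO(2)`, `z ↦ rotation by z ^ 2`, that satisfies the cocycle condition. -/
structure SpinStructure (h : Metric 2 M) (A : Type*) where
  U : A → Set M
  isOpen_U : ∀ a, IsOpen (U a)
  cover : ∀ x, ∃ a, x ∈ U a
  frame : A → Fin 2 → (x : M) → TangentSpace (𝓡 2) x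
  smooth_frame : ∀ a α, ContMDiffOn (𝓡 2) (𝓡 2).tangent ∞
    (fun x => (⟨x, frame a α x⟩ : TangentBundle (𝓡 2) M)) (U a)
  orthonormal : ∀ a, ∀ x ∈ U a, ∀ α β,
    h.inner x (frame a α x) (frame a β x) = if α = β then 1 else 0
  trans : A → A → M → Circle
  smooth_trans : ∀ a b, ContMDiffOn (𝓡 2) 𝓘(ℝ, ℂ) ∞ (fun x => (trans a b x : ℂ)) (U a ∩ U b)
  cocycle : ∀ a b c, ∀ x ∈ U a ∩ U b ∩ U c, trans a b x * trans b c x = trans a c x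
  lift_zero : ∀ a b, ∀ x ∈ U a ∩ U b, frame b 0 x =
    ((trans a b x : ℂ) ^ 2).re • frame a 0 x + ((trans a b x : ℂ) ^ 2).im • frame a 1 x
  lift_one : ∀ a b, ∀ x ∈ U a ∩ U b, frame b 1 x =
    -((trans a b x : ℂ) ^ 2).im • frame a 0 x + ((trans a b x : ℂ) ^ 2).re • frame a 1 x

/-- The derivative `X f` of a vector-valued function `f` along a vector field `X`. -/
def deriveAlong {V : Type*} [NormedAddCommGroup V] [NormedSpace ℝ V]
    (X : (x : M) → TangentSpace (𝓡 2) x) (f : M → V) (x : M) : V :=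
  mfderiv (𝓡 2) 𝓘(ℝ, V) f x (X x)

namespace SpinStructure

variable {h : Metric 2 M} {A : Type*} (σ : SpinStructure h A)

/-- `h([e_α, e_β], e_γ)` for the frame `e` with index `a`. -/
def bracketCoeff (a : A) (α β γ : Fin 2) (x : M) : ℝ :=
  h.inner x (VectorField.mlieBracket (𝓡 2) (σ.frame a α) (σ.frame a β) x) (σ.frame a γ x)

/-- `h(∇_{e_α} e_β, e_γ)` for the Levi-Civita connection of `h`, by the Koszul formula in the
orthonormal frame `e` with index `a`. -/
def connCoeff (a : A) (α β γ : Fin 2) (x : M) : ℝ :=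
  (1 / 2) * (σ.bracketCoeff a α β γ x - σ.bracketCoeff a β γ α x + σ.bracketCoeff a γ α β x)

/-- The Laplace-Beltrami operator with nonnegative spectrum, `Δ = -div grad`, computed in the
frame `e` with index `a`: `-Δ f = ∑_α (e_α (e_α f) - (∇_{e_α} e_α) f)`. -/
def laplacian {V : Type*} [NormedAddCommGroup V] [NormedSpace ℝ V]
    (a : A) (f : M → V) (x : M) : V :=
  -∑ α, (deriveAlong (σ.frame a α) (deriveAlong (σ.frame a α) f) x
    - ∑ γ, σ.connCoeff a α α γ x • deriveAlong (σ.frame a γ) f x)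

/-- The spin connection `∇_{e_α} χ = e_α χ + 1/4 ∑_{βγ} h(∇_{e_α} e_β, e_γ) e_β · e_γ · χ` on
spinor fields, in the trivialization with index `a`. -/
def spinConn (a : A) (α : Fin 2) (χ : M → Spinor) (x : M) : Spinor :=
  deriveAlong (σ.frame a α) χ x
    + (1 / 4 : ℝ) • ∑ β, ∑ γ, σ.connCoeff a α β γ x • cliff β (cliff γ (χ x))

/-- The Dirac operator `e_α · ∇_{e_α}` on spinor fields, in the trivialization with index `a`. -/
def dirac (a : A) (χ : M → Spinor) (x : M) : Spinor :=
  ∑ α, cliff α (σ.spinConn a α χ x)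

end SpinStructure

end Surface

/-! ### Riemannian geometry of the target in local coordinates

Throughout, `e` is a chart of `N` with coordinates `y¹, …, yⁿ`, and functions of the coordinates are
functions of a point `z` of the target of `e`. -/

section Target

variable {n : ℕ} {N : Type*} [TopologicalSpace N] [ChartedSpace (EuclideanSpace ℝ (Fin n)) N]
  [IsManifold (𝓡 n) ∞ N]

/-- The partial derivative `∂f/∂yⁱ`. -/
def pd {V : Type*} [NormedAddCommGroup V] [NormedSpace ℝ V] (i : Fin n)
    (f : EuclideanSpace ℝ (Fin n) → V) (z : EuclideanSpace ℝ (Fin n)) : V :=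
  fderiv ℝ f z (EuclideanSpace.single i 1)

/-- The coordinate vector field `∂/∂yⁱ` at the point with coordinates `z`. -/
def coordVec (e : OpenPartialHomeomorph N (EuclideanSpace ℝ (Fin n))) (i : Fin n)
    (z : EuclideanSpace ℝ (Fin n)) : TangentSpace (𝓡 n) (e.symm z) :=
  mfderiv (𝓡 n) (𝓡 n) e.symm z (EuclideanSpace.single i (1 : ℝ) : EuclideanSpace ℝ (Fin n))

/-- The differential of a real function on `N`, as a linear form on `T_yN`. -/
def diffAt (f : N → ℝ) (y : N) : TangentSpace (𝓡 n) y →ₗ[ℝ] ℝ :=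
  (mfderiv (𝓡 n) 𝓘(ℝ, ℝ) f y).toLinearMap

variable (g : Metric n N) (e : OpenPartialHomeomorph N (EuclideanSpace ℝ (Fin n)))

/-- The matrix `g_{ij}` of the metric. -/
def metricMatrix (z : EuclideanSpace ℝ (Fin n)) : Matrix (Fin n) (Fin n) ℝ :=
  Matrix.of fun i j => g.inner (e.symm z) (coordVec e i z) (coordVec e j z)

/-- The inverse matrix `g^{ij}`. -/
def invMetric (z : EuclideanSpace ℝ (Fin n)) : Matrix (Fin n) (Fin n) ℝ := (metricMatrix g e z)⁻¹

/-- The Christoffel symbol `Γ^m_{ij}` of the Levi-Civita connection of `g`. -/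
def christoffel (m i j : Fin n) (z : EuclideanSpace ℝ (Fin n)) : ℝ :=
  (1 / 2) * ∑ k, invMetric g e z m k *
    (pd i (fun w => metricMatrix g e w j k) z + pd j (fun w => metricMatrix g e w i k) z
      - pd k (fun w => metricMatrix g e w i j) z)

/-- The components `R^m_{lij}` of the curvature tensor, `R^m_{lij} ∂_m = R(∂_i, ∂_j) ∂_l` with
`R(X, Y) = ∇_X ∇_Y - ∇_Y ∇_X - ∇_{[X, Y]}`. -/
def curvUp (m l i j : Fin n) (z : EuclideanSpace ℝ (Fin n)) : ℝ :=
  pd i (christoffel g e m j l) z - pd j (christoffel g e m i l) z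
    + ∑ k, (christoffel g e m i k z * christoffel g e k j l z
      - christoffel g e m j k z * christoffel g e k i l z)

/-- `R_{ijkl} = g_{im} R^m_{jkl}`. -/
def curvLow (i j k l : Fin n) (z : EuclideanSpace ℝ (Fin n)) : ℝ :=
  ∑ m, metricMatrix g e z i m * curvUp g e m j k l z

/-- The covariant derivative `∇_p R_{ijkl}`. -/
def covCurv (p i j k l : Fin n) (z : EuclideanSpace ℝ (Fin n)) : ℝ :=
  pd p (curvLow g e i j k l) z
    - ∑ s, (christoffel g e s p i z * curvLow g e s j k l z
      + christoffel g e s p j z * curvLow g e i s k l z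
      + christoffel g e s p k z * curvLow g e i j s l z
      + christoffel g e s p l z * curvLow g e i j k s z)

/-! ### The second fundamental form and the shape operator of `ι : N → ℝ^q` -/

variable {q : ℕ} (ι : N → EuclideanSpace ℝ (Fin q))

/-- `ι` is a smooth isometric embedding of `(N, g)` into Euclidean space. -/
structure IsIsometricEmbedding : Prop where
  contMDiff : ContMDiff (𝓡 n) (𝓡 q) ∞ ι
  isEmbedding : Topology.IsEmbedding ι
  isometric : ∀ (y : N) (u v : TangentSpace (𝓡 n) y),
    inner (E := EuclideanSpace ℝ (Fin q)) ℝ (mfderiv (𝓡 n) (𝓡 q) ι y u)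
      (mfderiv (𝓡 n) (𝓡 q) ι y v) = g.inner y u v

/-- The coordinate vector field `∂/∂yⁱ`, seen in `ℝ^q`. -/
def pdEmb (i : Fin n) (z : EuclideanSpace ℝ (Fin n)) : EuclideanSpace ℝ (Fin q) :=
  pd i (fun w => ι (e.symm w)) z

/-- The projection of `ℝ^q` onto the normal space, the orthogonal complement of the tangent
space. -/
def normalProj (z : EuclideanSpace ℝ (Fin n)) (v : EuclideanSpace ℝ (Fin q)) :
    EuclideanSpace ℝ (Fin q) :=
  (Submodule.span ℝ (Set.range fun i => pdEmb e ι i z))ᗮ.starProjection v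

/-- The second fundamental form `II(∂_i, ∂_j)`: the normal part of `∂²ι/∂yⁱ∂yʲ`. -/
def secondFF (i j : Fin n) (z : EuclideanSpace ℝ (Fin n)) : EuclideanSpace ℝ (Fin q) :=
  normalProj e ι z (pd i (pdEmb e ι j) z)

/-- The covariant derivative `(∇_p II)(∂_i, ∂_j)`, for the normal connection and the Levi-Civita
connection of `g`. -/
def covSecondFF (p i j : Fin n) (z : EuclideanSpace ℝ (Fin n)) : EuclideanSpace ℝ (Fin q) :=
  normalProj e ι z (pd p (secondFF e ι i j) z)
    - ∑ s, (christoffel g e s p i z • secondFF e ι s j z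
      + christoffel g e s p j z • secondFF e ι i s z)

/-- The shape operator `P(ξ, ∂_i)` of a normal vector `ξ`: the tangent vector (seen in `ℝ^q`) with
`⟨P(ξ, ∂_i), ∂_k⟩ = ⟨II(∂_i, ∂_k), ξ⟩` for all `k`. -/
def shapeOp (ξ : EuclideanSpace ℝ (Fin q)) (i : Fin n) (z : EuclideanSpace ℝ (Fin n)) :
    EuclideanSpace ℝ (Fin q) :=
  ∑ m, (∑ k, invMetric g e z m k * ⟪secondFF e ι i k z, ξ⟫_ℝ) • pdEmb e ι m z

end Target

/-! ### Vector spinors and the two forms of the equations -/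

/-- Contraction of the second factor of a tensor product with a linear form. -/
def contract {T : Type*} [AddCommGroup T] [Module ℝ T] (ℓ : T →ₗ[ℝ] ℝ) :
    Spinor ⊗[ℝ] T →ₗ[ℝ] Spinor :=
  (TensorProduct.rid ℝ Spinor).toLinearMap ∘ₗ LinearMap.lTensor Spinor ℓ

section Equations

variable {M : Type*} [TopologicalSpace M] [ChartedSpace (EuclideanSpace ℝ (Fin 2)) M]
  [IsManifold (𝓡 2) ∞ M] {h : Metric 2 M} {A : Type*}
  {n : ℕ} {N : Type*} [TopologicalSpace N] [ChartedSpace (EuclideanSpace ℝ (Fin n)) N]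
  [IsManifold (𝓡 n) ∞ N]

/-- A vector spinor along `φ`: a smooth section of `ΣM ⊗ φ⁻¹TN`, given by its representatives
in the trivializations of `ΣM` that belong to the spin structure. -/
structure VectorSpinor (σ : SpinStructure h A) (φ : M → N) where
  toFun : A → (x : M) → Spinor ⊗[ℝ] TangentSpace (𝓡 n) (φ x)
  compat : ∀ a b, ∀ x ∈ σ.U a ∩ σ.U b, toFun a x =
    LinearMap.rTensor (TangentSpace (𝓡 n) (φ x))
      ((spinRep (σ.trans a b x)).restrictScalars ℝ) (toFun b x)
  smooth : ∀ a, ∀ e ∈ IsManifold.maximalAtlas (𝓡 n) ∞ N, ∀ i : Fin n,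
    ContMDiffOn (𝓡 2) 𝓘(ℝ, Spinor) ∞
      (fun x => contract (diffAt (fun y => e y i) (φ x)) (toFun a x))
      (σ.U a ∩ φ ⁻¹' e.source)

variable {σ : SpinStructure h A} {φ : M → N} (ψ : VectorSpinor (n := n) σ φ)
  (g : Metric n N) (e : OpenPartialHomeomorph N (EuclideanSpace ℝ (Fin n)))
  {q : ℕ} (ι : N → EuclideanSpace ℝ (Fin q)) (a : A)

/-- `dφⁱ(e_α)`, the components of `dφ(e_α)`. -/
def dmap (σ : SpinStructure h A) (φ : M → N)
    (e : OpenPartialHomeomorph N (EuclideanSpace ℝ (Fin n))) (a : A)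
    (i : Fin n) (α : Fin 2) (x : M) : ℝ :=
  deriveAlong (σ.frame a α) (fun w => e (φ w) i) x

/-- Clifford multiplication `∇φⁱ · χ = ∑_α dφⁱ(e_α) e_α · χ`. -/
def gradCliff (σ : SpinStructure h A) (φ : M → N)
    (e : OpenPartialHomeomorph N (EuclideanSpace ℝ (Fin n))) (a : A)
    (i : Fin n) (x : M) (χ : Spinor) : Spinor :=
  ∑ α, dmap σ φ e a i α x • cliff α χ

/-- The components `τ^m(φ)` of the tension field `τ(φ) = tr ∇dφ`. -/
def tension (σ : SpinStructure h A) (φ : M → N) (g : Metric n N)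
    (e : OpenPartialHomeomorph N (EuclideanSpace ℝ (Fin n))) (a : A) (m : Fin n) (x : M) : ℝ :=
  -σ.laplacian a (fun w => e (φ w) m) x
    + ∑ α, ∑ i, ∑ j, christoffel g e m i j (e (φ x)) * dmap σ φ e a i α x * dmap σ φ e a j α x

/-- The spinors `ψⁱ` with `ψ = ψⁱ ⊗ ∂/∂yⁱ`. -/
def VectorSpinor.comp (i : Fin n) (x : M) : Spinor :=
  contract (diffAt (fun y => e y i) (φ x)) (ψ.toFun a x)

/-- The `B`-th of the `q` spinors that form the image of `ψ` in `ΣM ⊗ Tℝ^q` under `id ⊗ dι`. -/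
def VectorSpinor.ambient (B : Fin q) (x : M) : Spinor :=
  contract (diffAt (fun y => ι y B) (φ x)) (ψ.toFun a x)

/-- The components of `∇̃_{e_α} ψ` for the connection induced on `ΣM ⊗ φ⁻¹TN`. -/
def twistedConn (m : Fin n) (α : Fin 2) (x : M) : Spinor :=
  σ.spinConn a α (ψ.comp e a m) x
    + ∑ j, ∑ k, (christoffel g e m j k (e (φ x)) * dmap σ φ e a j α x) • ψ.comp e a k x

/-- The components of the twisted Dirac operator `e_α · ∇̃_{e_α} ψ`. -/
def twistedDirac (m : Fin n) (x : M) : Spinor :=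
  ∑ α, cliff α (twistedConn ψ g e a m α x)

/-- The Euler-Lagrange equation `τ(φ) = 𝓡(φ, ψ) - 𝓡̃(ψ)` at `x` in local coordinates:
`τ^m = 1/2 R^m_{lij} ⟨ψⁱ, ∇φˡ · ψʲ⟩ - 1/12 g^{mp} (∇_p R_{ijkl}) ⟨ψⁱ, ψᵏ⟩ ⟨ψʲ, ψˡ⟩`. -/
def EulerLagrangeMap (x : M) : Prop :=
  ∀ m : Fin n, (tension σ φ g e a m x : ℂ) =
    (1 / 2) * ∑ l, ∑ i, ∑ j, (curvUp g e m l i j (e (φ x)) : ℂ) *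
        ⟪ψ.comp e a i x, gradCliff σ φ e a l x (ψ.comp e a j x)⟫_ℂ
    - (1 / 12) * ∑ p, ∑ i, ∑ j, ∑ k, ∑ l,
        (invMetric g e (e (φ x)) m p : ℂ) * (covCurv g e p i j k l (e (φ x)) : ℂ) *
        ⟪ψ.comp e a i x, ψ.comp e a k x⟫_ℂ * ⟪ψ.comp e a j x, ψ.comp e a l x⟫_ℂ

/-- The Euler-Lagrange equation `D̸ψ = 1/3 R^N(ψ, ψ)ψ` at `x` in local coordinates:
`(D̸ψ)^m = 1/3 R^m_{jkl} ⟨ψʲ, ψˡ⟩ ψᵏ`. -/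
def EulerLagrangeSpinor (x : M) : Prop :=
  ∀ m : Fin n, twistedDirac ψ g e a m x =
    (1 / 3 : ℂ) • ∑ j, ∑ k, ∑ l, ((curvUp g e m j k l (e (φ x)) : ℂ) *
        ⟪ψ.comp e a j x, ψ.comp e a l x⟫_ℂ) • ψ.comp e a k x

/-- `II(dφ, dφ) = ∑_α II(dφ(e_α), dφ(e_α))`. -/
def termII (σ : SpinStructure h A) (φ : M → N)
    (e : OpenPartialHomeomorph N (EuclideanSpace ℝ (Fin n)))
    (ι : N → EuclideanSpace ℝ (Fin q)) (a : A) (x : M) : EuclideanSpace ℝ (Fin q) :=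
  ∑ α, ∑ i, ∑ j, (dmap σ φ e a i α x * dmap σ φ e a j α x) • secondFF e ι i j (e (φ x))

/-- `P(II(e_α · ψ, dφ(e_α)), ψ) = Re ⟨ψⁱ, ∇φˡ · ψʲ⟩ P(II(∂_j, ∂_l), ∂_i)`. -/
def termP (x : M) : EuclideanSpace ℝ (Fin q) :=
  ∑ l, ∑ i, ∑ j,
    (⟪ψ.comp e a i x, gradCliff σ φ e a l x (ψ.comp e a j x)⟫_ℂ).re •
      shapeOp g e ι (secondFF e ι j l (e (φ x))) i (e (φ x))

/-- The `B`-th component of `G(ψ)`, that is, of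
`1/6 (⟨∇_p II(∂_i, ∂_k), II(∂_j, ∂_l)⟩ - ⟨∇_p II(∂_i, ∂_l), II(∂_j, ∂_k)⟩) ⟨ψⁱ, ψᵏ⟩ ⟨ψʲ, ψˡ⟩`
with the index `p` raised. -/
def termG (B : Fin q) (x : M) : ℂ :=
  (1 / 6) * ∑ m, ∑ p, ((invMetric g e (e (φ x)) m p * pdEmb e ι m (e (φ x)) B : ℝ) : ℂ) *
    ∑ i, ∑ j, ∑ k, ∑ l,
      ((⟪covSecondFF g e ι p i k (e (φ x)), secondFF e ι j l (e (φ x))⟫_ℝ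
        - ⟪covSecondFF g e ι p i l (e (φ x)), secondFF e ι j k (e (φ x))⟫_ℝ : ℝ) : ℂ) *
      ⟪ψ.comp e a i x, ψ.comp e a k x⟫_ℂ * ⟪ψ.comp e a j x, ψ.comp e a l x⟫_ℂ

/-- The `B`-th component of
`F(ψ, ψ)ψ = 1/3 (P(II(∂_l, ∂_j), ∂_k) - P(II(∂_k, ∂_j), ∂_l)) ⟨ψʲ, ψˡ⟩ ψᵏ`. -/
def termF (B : Fin q) (x : M) : Spinor :=
  (1 / 3 : ℂ) • ∑ j, ∑ k, ∑ l,
    ((((shapeOp g e ι (secondFF e ι l j (e (φ x))) k (e (φ x))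
        - shapeOp g e ι (secondFF e ι k j (e (φ x))) l (e (φ x))) B : ℝ) : ℂ) *
      ⟪ψ.comp e a j x, ψ.comp e a l x⟫_ℂ) • ψ.comp e a k x

/-- The `B`-th component of `II(dφ(e_α), e_α · ψ)`. -/
def termIISpinor (B : Fin q) (x : M) : Spinor :=
  ∑ i, ∑ j, (secondFF e ι i j (e (φ x)) B) • gradCliff σ φ e a i x (ψ.comp e a j x)

/-- The equation `-Δφ = II(dφ, dφ) + P(II(e_α · ψ, dφ(e_α)), ψ) - G(ψ)` in `ℝ^q` at `x`. -/
def ExtrinsicMap (x : M) : Prop :=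
  ∀ B : Fin q, (((-σ.laplacian a (fun w => ι (φ w)) x) B : ℝ) : ℂ) =
    ((termII σ φ e ι a x B : ℝ) : ℂ) + ((termP ψ g e ι a x B : ℝ) : ℂ) - termG ψ g e ι a B x

/-- The equation `∂̸ψ = II(dφ(e_α), e_α · ψ) + F(ψ, ψ)ψ` in `ΣM ⊗ ℝ^q` at `x`. -/
def ExtrinsicSpinor (x : M) : Prop :=
  ∀ B : Fin q, σ.dirac a (ψ.ambient ι a B) x =
    termIISpinor ψ e ι a B x + termF ψ g e ι a B x

end Equations

end DiracHarmonic

end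

/-! Write X_i for the coordinate field ∂_i seen in ℝ^q. Everything rests on the Gauss formula ∂_i
X_j = Γ^m_ij X_m + II_ij (`pd_pdEmb`). Differentiating ι ∘ φ twice by the chain rule and inserting
it gives -Δ(ι ∘ φ) = τ^m(φ) X_m + II(dφ, dφ) (`neg_laplacian_comp`). In the same way ψ^B = X_i^B ψ^i
gives ∂̸ψ = (D̸ψ)^m ⊗ X_m + II(dφ(e_α), e_α · ψ) (`dirac_ambient`). So the normal terms of both
extrinsic equations cancel, and the remaining terms P, G and F are tangential. Each equation becomes
an identity between combinations of the X_m. These are linearly independent, also with complex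
numbers or spinors as coefficients (`sum_pdEmb_smul_eq_iff`), so it suffices to match coefficients.

The matching is the Gauss equation (`curvLow_eq`, with raised index `curvUp_eq`). For F it applies
directly (`shapeOp_sub_shapeOp`). For P, Clifford multiplication is skew-Hermitian, so
antisymmetrizing ⟨ψⁱ, ∇φˡ · ψʲ⟩ in i, j gives twice its real part, which absorbs the factor 1/2
(`sum_curvUp_mul_inner`). For G, the differentiated Gauss equation has four terms (`covCurv_eq`);
the exchange of (i, k) with (j, l) preserves the spinor factor and identifies them in pairs, so 1/12
becomes 1/6 (`sum_covCurv_mul`). -/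

namespace DiracHarmonic

/-! ### Coordinate calculus on the target: metric, Gauss formula, Weingarten relation, Gauss
equation. -/

section TargetGeometry

lemma contDiffAt_pd {n : ℕ} {V : Type*} [NormedAddCommGroup V] [NormedSpace ℝ V]
    {f : EuclideanSpace ℝ (Fin n) → V} {z : EuclideanSpace ℝ (Fin n)}
    (hf : ContDiffAt ℝ ∞ f z) (i : Fin n) : ContDiffAt ℝ ∞ (pd i f) z :=
  (hf.fderiv_right (m := ∞) (by simp)).clm_apply contDiffAt_const

lemma pd_congr {n : ℕ} {V : Type*} [NormedAddCommGroup V] [NormedSpace ℝ V]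
    {f f' : EuclideanSpace ℝ (Fin n) → V} {z : EuclideanSpace ℝ (Fin n)}
    (hf : f =ᶠ[nhds z] f') (i : Fin n) : pd i f z = pd i f' z := by
  simp only [pd, hf.fderiv_eq]

lemma pd_add {n : ℕ} {V : Type*} [NormedAddCommGroup V] [NormedSpace ℝ V]
    {f f' : EuclideanSpace ℝ (Fin n) → V} {z : EuclideanSpace ℝ (Fin n)}
    (hf : DifferentiableAt ℝ f z) (hf' : DifferentiableAt ℝ f' z) (i : Fin n) :
    pd i (fun w => f w + f' w) z = pd i f z + pd i f' z := by
  simp only [pd, fderiv_fun_add hf hf', add_apply]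

lemma pd_sub {n : ℕ} {V : Type*} [NormedAddCommGroup V] [NormedSpace ℝ V]
    {f f' : EuclideanSpace ℝ (Fin n) → V} {z : EuclideanSpace ℝ (Fin n)}
    (hf : DifferentiableAt ℝ f z) (hf' : DifferentiableAt ℝ f' z) (i : Fin n) :
    pd i (fun w => f w - f' w) z = pd i f z - pd i f' z := by
  simp only [pd, fderiv_fun_sub hf hf', sub_apply]

lemma pd_sum_smul {n : ℕ} {V : Type*} [NormedAddCommGroup V] [NormedSpace ℝ V]
    {c : Fin n → EuclideanSpace ℝ (Fin n) → ℝ} {f : Fin n → EuclideanSpace ℝ (Fin n) → V}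
    {z : EuclideanSpace ℝ (Fin n)} (hc : ∀ m, DifferentiableAt ℝ (c m) z)
    (hf : ∀ m, DifferentiableAt ℝ (f m) z) (i : Fin n) :
    pd i (fun w => ∑ m, c m w • f m w) z =
      ∑ m, (c m z • pd i (f m) z + pd i (c m) z • f m z) := by
  simp only [pd]
  rw [fderiv_fun_sum fun m _ => (hc m).fun_smul (hf m)]
  simp only [sum_apply]
  exact Finset.sum_congr rfl fun m _ => by simp [fderiv_fun_smul (hc m) (hf m)]

lemma pd_inner {n q : ℕ} {f f' : EuclideanSpace ℝ (Fin n) → EuclideanSpace ℝ (Fin q)}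
    {z : EuclideanSpace ℝ (Fin n)}
    (hf : DifferentiableAt ℝ f z) (hf' : DifferentiableAt ℝ f' z) (i : Fin n) :
    pd i (fun w => ⟪f w, f' w⟫_ℝ) z = ⟪f z, pd i f' z⟫_ℝ + ⟪pd i f z, f' z⟫_ℝ := by
  simp only [pd, fderiv_inner_apply ℝ hf hf']

variable {n : ℕ} {N : Type*} [TopologicalSpace N] [ChartedSpace (EuclideanSpace ℝ (Fin n)) N]
  [IsManifold (𝓡 n) ∞ N] {g : Metric n N} {e : OpenPartialHomeomorph N (EuclideanSpace ℝ (Fin n))}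
  {q : ℕ} {ι : N → EuclideanSpace ℝ (Fin q)} {z : EuclideanSpace ℝ (Fin n)}

omit [IsManifold (𝓡 n) ∞ N] in
lemma mdifferentiableAt_symm_of_mem_target (he : e ∈ IsManifold.maximalAtlas (𝓡 n) ∞ N)
    (hz : z ∈ e.target) : MDifferentiableAt (𝓡 n) (𝓡 n) e.symm z :=
  (contMDiffAt_symm_of_mem_maximalAtlas he hz).mdifferentiableAt (by simp)

lemma IsIsometricEmbedding.contDiffAt_comp_symm (hι : IsIsometricEmbedding g ι)
    (he : e ∈ IsManifold.maximalAtlas (𝓡 n) ∞ N) (hz : z ∈ e.target) :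
    ContDiffAt ℝ ∞ (fun w => ι (e.symm w)) z :=
  (hι.contMDiff.contMDiffAt.comp z
    (contMDiffAt_symm_of_mem_maximalAtlas he hz)).contDiffAt

lemma IsIsometricEmbedding.fderiv_comp_symm (hι : IsIsometricEmbedding g ι)
    (he : e ∈ IsManifold.maximalAtlas (𝓡 n) ∞ N) (hz : z ∈ e.target)
    (v : EuclideanSpace ℝ (Fin n)) :
    fderiv ℝ (fun w => ι (e.symm w)) z v =
      mfderiv (𝓡 n) (𝓡 q) ι (e.symm z) (mfderiv (𝓡 n) (𝓡 n) e.symm z v) := by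
  have h := mfderiv_comp z (hι.contMDiff.mdifferentiableAt (by simp) (x := e.symm z))
    (mdifferentiableAt_symm_of_mem_target he hz)
  rw [← mfderiv_eq_fderiv]
  exact congrArg (fun T => T v) h

lemma IsIsometricEmbedding.inner_fderiv (hι : IsIsometricEmbedding g ι)
    (he : e ∈ IsManifold.maximalAtlas (𝓡 n) ∞ N) (hz : z ∈ e.target)
    (v w : EuclideanSpace ℝ (Fin n)) :
    ⟪fderiv ℝ (fun w => ι (e.symm w)) z v, fderiv ℝ (fun w => ι (e.symm w)) z w⟫_ℝ =
      g.inner (e.symm z) (mfderiv (𝓡 n) (𝓡 n) e.symm z v) (mfderiv (𝓡 n) (𝓡 n) e.symm z w) := by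
  rw [hι.fderiv_comp_symm he hz, hι.fderiv_comp_symm he hz]
  exact hι.isometric _ _ _

/-- Isometry makes g_ij the Gram matrix of the X_i. All later regularity and derivative formulas for
g are read off from ι through this identity. -/
lemma IsIsometricEmbedding.metricMatrix_apply (hι : IsIsometricEmbedding g ι)
    (he : e ∈ IsManifold.maximalAtlas (𝓡 n) ∞ N) (hz : z ∈ e.target) (i j : Fin n) :
    metricMatrix g e z i j = ⟪pdEmb e ι i z, pdEmb e ι j z⟫_ℝ :=
  (hι.inner_fderiv he hz _ _).symm

omit [IsManifold (𝓡 n) ∞ N] in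
-- Chain rule for `e ∘ e.symm`, which is the identity near z: the differential of `e` is a left
-- inverse.
lemma injective_mfderiv_symm (he : e ∈ IsManifold.maximalAtlas (𝓡 n) ∞ N) (hz : z ∈ e.target)
    {v : EuclideanSpace ℝ (Fin n)} (hv : mfderiv (𝓡 n) (𝓡 n) e.symm z v = 0) : v = 0 := by
  have h1 : MDifferentiableAt (𝓡 n) (𝓡 n) e (e.symm z) :=
    (contMDiffAt_of_mem_maximalAtlas he (e.map_target hz)).mdifferentiableAt (by simp)
  have h2 := mfderiv_comp z h1 (mdifferentiableAt_symm_of_mem_target he hz)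
  have h3 : (e ∘ e.symm) =ᶠ[nhds z] id := e.eventually_right_inverse hz
  rw [h3.mfderiv_eq, mfderiv_id] at h2
  have h4 := congrArg (fun T => T v) h2
  change v = mfderiv (𝓡 n) (𝓡 n) e (e.symm z) (mfderiv (𝓡 n) (𝓡 n) e.symm z v) at h4
  rw [hv, map_zero] at h4
  exact h4

lemma IsIsometricEmbedding.det_metricMatrix_ne_zero (hι : IsIsometricEmbedding g ι)
    (he : e ∈ IsManifold.maximalAtlas (𝓡 n) ∞ N) (hz : z ∈ e.target) :
    (metricMatrix g e z).det ≠ 0 := by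
  intro h
  obtain ⟨c, hc, hG⟩ := Matrix.exists_mulVec_eq_zero_iff.2 h
  apply hc
  set v : EuclideanSpace ℝ (Fin n) := WithLp.toLp 2 c with hvdef
  have hv : v = ∑ i, c i • EuclideanSpace.single i (1 : ℝ) := by
    ext j; simp [hvdef, Finset.sum_apply, Pi.single_apply]
  have hT : fderiv ℝ (fun w => ι (e.symm w)) z v = ∑ i, c i • pdEmb e ι i z := by
    rw [hv, map_sum]; simp [pdEmb, pd]
  -- A kernel vector c of the Gram matrix satisfies cᵀ g c = 0, which is the squared g-length of the
  -- tangent vector with components c; positivity of g then kills that vector.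
  have h0 : g.inner (e.symm z) (mfderiv (𝓡 n) (𝓡 n) e.symm z v)
      (mfderiv (𝓡 n) (𝓡 n) e.symm z v) = 0 := by
    rw [← hι.inner_fderiv he hz v v, hT, sum_inner]
    refine Finset.sum_eq_zero fun i _ => ?_
    rw [inner_smul_left, inner_sum]
    have := congrFun hG i
    simp only [Matrix.mulVec, dotProduct, hι.metricMatrix_apply he hz, Pi.zero_apply] at this
    simp only [inner_smul_right, mul_comm (c _)]
    rw [this, mul_zero]
  have hw : mfderiv (𝓡 n) (𝓡 n) e.symm z v = 0 := by
    by_contra hne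
    exact (g.pos _ _ hne).ne' h0
  have := injective_mfderiv_symm he hz hw
  funext i
  simpa [hvdef] using congrArg (fun u : EuclideanSpace ℝ (Fin n) => u i) this

lemma IsIsometricEmbedding.contDiffAt_pdEmb (hι : IsIsometricEmbedding g ι)
    (he : e ∈ IsManifold.maximalAtlas (𝓡 n) ∞ N) (hz : z ∈ e.target) (i : Fin n) :
    ContDiffAt ℝ ∞ (pdEmb e ι i) z :=
  contDiffAt_pd (hι.contDiffAt_comp_symm he hz) i

omit [ChartedSpace (EuclideanSpace ℝ (Fin n)) N] [IsManifold (𝓡 n) ∞ N] in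
lemma eventually_mem_target (hz : z ∈ e.target) : ∀ᶠ w in nhds z, w ∈ e.target :=
  e.open_target.mem_nhds hz

lemma IsIsometricEmbedding.contDiffAt_metricMatrix (hι : IsIsometricEmbedding g ι)
    (he : e ∈ IsManifold.maximalAtlas (𝓡 n) ∞ N) (hz : z ∈ e.target) (i j : Fin n) :
    ContDiffAt ℝ ∞ (fun w => metricMatrix g e w i j) z := by
  refine ((hι.contDiffAt_pdEmb he hz i).inner ℝ
    (hι.contDiffAt_pdEmb he hz j)).congr_of_eventuallyEq ?_
  filter_upwards [eventually_mem_target hz] with w hw using hι.metricMatrix_apply he hw i j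

lemma contDiffAt_det {E : Type*} [NormedAddCommGroup E] [NormedSpace ℝ E]
    {A : E → Matrix (Fin n) (Fin n) ℝ} {z : E}
    (hA : ∀ i j, ContDiffAt ℝ ∞ (fun w => A w i j) z) : ContDiffAt ℝ ∞ (fun w => (A w).det) z := by
  simp only [Matrix.det_apply']
  exact ContDiffAt.sum fun s _ => contDiffAt_const.mul (contDiffAt_prod fun i _ => hA _ _)

/-- Cramer's rule: each entry of the inverse is det⁻¹ times the determinant of A with row j replaced
by a constant basis vector. -/
lemma contDiffAt_inv_matrix {E : Type*} [NormedAddCommGroup E] [NormedSpace ℝ E]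
    {A : E → Matrix (Fin n) (Fin n) ℝ} {z : E}
    (hA : ∀ i j, ContDiffAt ℝ ∞ (fun w => A w i j) z) (hz : (A z).det ≠ 0) (i j : Fin n) :
    ContDiffAt ℝ ∞ (fun w => (A w)⁻¹ i j) z := by
  simp only [Matrix.inv_def, Ring.inverse_eq_inv', Matrix.smul_apply, smul_eq_mul,
    Matrix.adjugate_apply]
  refine ((contDiffAt_det hA).inv hz).mul (contDiffAt_det fun k l => ?_)
  by_cases h : k = j
  · subst h; simpa using contDiffAt_const
  · simpa [Matrix.updateRow_ne h] using hA k l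

lemma IsIsometricEmbedding.contDiffAt_christoffel (hι : IsIsometricEmbedding g ι)
    (he : e ∈ IsManifold.maximalAtlas (𝓡 n) ∞ N) (hz : z ∈ e.target) (m i j : Fin n) :
    ContDiffAt ℝ ∞ (christoffel g e m i j) z := by
  have hG := fun i j => hι.contDiffAt_metricMatrix he hz i j
  refine contDiffAt_const.mul (ContDiffAt.sum fun k _ => ?_)
  exact (contDiffAt_inv_matrix hG (hι.det_metricMatrix_ne_zero he hz) m k).mul
    (((contDiffAt_pd (hG j k) i).add (contDiffAt_pd (hG i k) j)).sub (contDiffAt_pd (hG i j) k))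

lemma IsIsometricEmbedding.sum_metricMatrix_mul_invMetric (hι : IsIsometricEmbedding g ι)
    (he : e ∈ IsManifold.maximalAtlas (𝓡 n) ∞ N) (hz : z ∈ e.target) (i j : Fin n) :
    ∑ m, metricMatrix g e z i m * invMetric g e z m j = if i = j then 1 else 0 := by
  have := Matrix.mul_nonsing_inv (metricMatrix g e z)
    (isUnit_iff_ne_zero.2 (hι.det_metricMatrix_ne_zero he hz))
  simpa [invMetric, Matrix.mul_apply, Matrix.one_apply] using congrFun (congrFun this i) j

lemma IsIsometricEmbedding.sum_invMetric_mul_metricMatrix (hι : IsIsometricEmbedding g ι)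
    (he : e ∈ IsManifold.maximalAtlas (𝓡 n) ∞ N) (hz : z ∈ e.target) (i j : Fin n) :
    ∑ m, invMetric g e z i m * metricMatrix g e z m j = if i = j then 1 else 0 := by
  have := Matrix.nonsing_inv_mul (metricMatrix g e z)
    (isUnit_iff_ne_zero.2 (hι.det_metricMatrix_ne_zero he hz))
  simpa [invMetric, Matrix.mul_apply, Matrix.one_apply] using congrFun (congrFun this i) j

/-- Second partial derivatives commute. -/
lemma pd_comm {V : Type*} [NormedAddCommGroup V] [NormedSpace ℝ V]
    {f : EuclideanSpace ℝ (Fin n) → V} (hf : ContDiffAt ℝ ∞ f z) (i j : Fin n) :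
    pd i (pd j f) z = pd j (pd i f) z := by
  have hd : DifferentiableAt ℝ (fderiv ℝ f) z :=
    (hf.fderiv_right (m := ∞) (by simp)).differentiableAt (by simp)
  have hs : IsSymmSndFDerivAt ℝ f z := hf.isSymmSndFDerivAt
    (by simpa using WithTop.coe_le_coe.2 (le_top : (2 : ℕ∞) ≤ ⊤))
  have key : ∀ i j : Fin n, pd i (pd j f) z =
      fderiv ℝ (fderiv ℝ f) z (EuclideanSpace.single i 1) (EuclideanSpace.single j 1) := by
    intro i j
    change fderiv ℝ (fun w => fderiv ℝ f w (EuclideanSpace.single j 1)) z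
      (EuclideanSpace.single i 1) = _
    rw [fderiv_clm_apply hd (differentiableAt_const _)]
    simp
  rw [key, key, hs.eq]

lemma IsIsometricEmbedding.pd_pdEmb_comm (hι : IsIsometricEmbedding g ι)
    (he : e ∈ IsManifold.maximalAtlas (𝓡 n) ∞ N) (hz : z ∈ e.target) (i j : Fin n) :
    pd i (pdEmb e ι j) z = pd j (pdEmb e ι i) z :=
  pd_comm (hι.contDiffAt_comp_symm he hz) i j

omit [ChartedSpace (EuclideanSpace ℝ (Fin n)) N] [IsManifold (𝓡 n) ∞ N] in
lemma inner_normalProj_pdEmb (v : EuclideanSpace ℝ (Fin q)) (k : Fin n) :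
    ⟪normalProj e ι z v, pdEmb e ι k z⟫_ℝ = 0 :=
  Submodule.inner_left_of_mem_orthogonal
    (Submodule.subset_span (Set.mem_range_self k)) (Submodule.starProjection_apply_mem _ v)

omit [ChartedSpace (EuclideanSpace ℝ (Fin n)) N] [IsManifold (𝓡 n) ∞ N] in
lemma inner_secondFF_pdEmb (i j k : Fin n) : ⟪secondFF e ι i j z, pdEmb e ι k z⟫_ℝ = 0 :=
  inner_normalProj_pdEmb _ k

omit [ChartedSpace (EuclideanSpace ℝ (Fin n)) N] [IsManifold (𝓡 n) ∞ N] in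
-- The orthogonal projection is self-adjoint and fixes the normal vector II_ij. Hence the projection
-- in the definition of ∇II disappears as soon as ∇II is paired with II.
lemma inner_normalProj_secondFF (v : EuclideanSpace ℝ (Fin q)) (i j : Fin n) :
    ⟪normalProj e ι z v, secondFF e ι i j z⟫_ℝ = ⟪v, secondFF e ι i j z⟫_ℝ := by
  rw [normalProj, Submodule.inner_starProjection_left_eq_right]
  congr 1
  exact Submodule.starProjection_eq_self_iff.2 (Submodule.starProjection_apply_mem _ _)

omit [ChartedSpace (EuclideanSpace ℝ (Fin n)) N] [IsManifold (𝓡 n) ∞ N] in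
lemma normalProj_eq_sub (c : Fin n → ℝ) (v : EuclideanSpace ℝ (Fin q))
    (h : ∀ k, ⟪v - ∑ m, c m • pdEmb e ι m z, pdEmb e ι k z⟫_ℝ = 0) :
    normalProj e ι z v = v - ∑ m, c m • pdEmb e ι m z := by
  refine Submodule.eq_starProjection_of_mem_orthogonal
    (K := (Submodule.span ℝ (Set.range fun i => pdEmb e ι i z))ᗮ) ?_ ?_
  · rw [Submodule.mem_orthogonal']
    intro u hu
    induction hu using Submodule.span_induction with
    | mem x hx => obtain ⟨k, rfl⟩ := hx; exact h k
    | zero => exact inner_zero_right _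
    | add x y _ _ hx hy => rw [inner_add_right, hx, hy, add_zero]
    | smul r x _ hx => rw [inner_smul_right, hx, mul_zero]
  -- The part removed is tangential, hence orthogonal to the normal space; only the inclusion of the
  -- tangent space in its double complement is needed.
  · rw [sub_sub_cancel]
    exact Submodule.le_orthogonal_orthogonal _ (Submodule.sum_mem _ fun m _ =>
      Submodule.smul_mem _ _ (Submodule.subset_span (Set.mem_range_self m)))

lemma IsIsometricEmbedding.pd_metricMatrix (hι : IsIsometricEmbedding g ι)
    (he : e ∈ IsManifold.maximalAtlas (𝓡 n) ∞ N) (hz : z ∈ e.target) (k i j : Fin n) :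
    pd k (fun w => metricMatrix g e w i j) z =
      ⟪pdEmb e ι i z, pd k (pdEmb e ι j) z⟫_ℝ + ⟪pd k (pdEmb e ι i) z, pdEmb e ι j z⟫_ℝ := by
  rw [← pd_inner ((hι.contDiffAt_pdEmb he hz i).differentiableAt (by simp))
    ((hι.contDiffAt_pdEmb he hz j).differentiableAt (by simp))]
  refine pd_congr ?_ k
  filter_upwards [eventually_mem_target hz] with w hw using hι.metricMatrix_apply he hw i j

/-- Each derivative of g_ij = ⟨X_i, X_j⟩ gives two products. Since ∂_i X_j is symmetric in i and j,
four of the six cancel and the other two coincide, which uses up the factor 1/2. -/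
lemma IsIsometricEmbedding.christoffel_eq (hι : IsIsometricEmbedding g ι)
    (he : e ∈ IsManifold.maximalAtlas (𝓡 n) ∞ N) (hz : z ∈ e.target) (m i j : Fin n) :
    christoffel g e m i j z =
      ∑ k, invMetric g e z m k * ⟪pd i (pdEmb e ι j) z, pdEmb e ι k z⟫_ℝ := by
  rw [christoffel, Finset.mul_sum]
  refine Finset.sum_congr rfl fun k _ => ?_
  rw [hι.pd_metricMatrix he hz, hι.pd_metricMatrix he hz, hι.pd_metricMatrix he hz,
    hι.pd_pdEmb_comm he hz j i, hι.pd_pdEmb_comm he hz k i, hι.pd_pdEmb_comm he hz k j,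
    real_inner_comm (pdEmb e ι j z) (pd i (pdEmb e ι k) z)]
  ring

/-- The Gauss formula. -/
lemma IsIsometricEmbedding.pd_pdEmb (hι : IsIsometricEmbedding g ι)
    (he : e ∈ IsManifold.maximalAtlas (𝓡 n) ∞ N) (hz : z ∈ e.target) (i j : Fin n) :
    pd i (pdEmb e ι j) z =
      ∑ m, christoffel g e m i j z • pdEmb e ι m z + secondFF e ι i j z := by
  rw [secondFF, normalProj_eq_sub (fun m => christoffel g e m i j z), add_sub_cancel]
  intro k
  simp only [inner_sub_left, sum_inner, inner_smul_left, hι.christoffel_eq he hz,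
    ← hι.metricMatrix_apply he hz, conj_trivial, Finset.sum_mul]
  rw [Finset.sum_comm, sub_eq_zero]
  -- The contraction runs over the first index of both matrices, so the symmetry of g is needed
  -- before the inverse relation applies.
  have hG : ∀ l, ∑ m, invMetric g e z m l * metricMatrix g e z m k = if k = l then 1 else 0 := by
    intro l
    rw [← hι.sum_metricMatrix_mul_invMetric he hz k l]
    refine Finset.sum_congr rfl fun m _ => ?_
    rw [mul_comm, hι.metricMatrix_apply he hz, hι.metricMatrix_apply he hz, real_inner_comm]
  have : ∀ l, ∑ m, invMetric g e z m l * ⟪pd i (pdEmb e ι j) z, pdEmb e ι l z⟫_ℝ *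
      metricMatrix g e z m k =
      (if k = l then 1 else 0) * ⟪pd i (pdEmb e ι j) z, pdEmb e ι l z⟫_ℝ := by
    intro l
    rw [← hG l, Finset.sum_mul]
    exact Finset.sum_congr rfl fun m _ => by ring
  simp [this]

lemma IsIsometricEmbedding.christoffel_symm (hι : IsIsometricEmbedding g ι)
    (he : e ∈ IsManifold.maximalAtlas (𝓡 n) ∞ N) (hz : z ∈ e.target) (m i j : Fin n) :
    christoffel g e m i j z = christoffel g e m j i z := by
  simp only [hι.christoffel_eq he hz, hι.pd_pdEmb_comm he hz i j]

lemma IsIsometricEmbedding.secondFF_symm (hι : IsIsometricEmbedding g ι)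
    (he : e ∈ IsManifold.maximalAtlas (𝓡 n) ∞ N) (hz : z ∈ e.target) (i j : Fin n) :
    secondFF e ι i j z = secondFF e ι j i z := by
  simp only [secondFF, hι.pd_pdEmb_comm he hz i j]

/-- The Gauss formula writes II_ij near z as a difference of smooth terms, so the point-dependent
normal projection never has to be differentiated. -/
lemma IsIsometricEmbedding.contDiffAt_secondFF (hι : IsIsometricEmbedding g ι)
    (he : e ∈ IsManifold.maximalAtlas (𝓡 n) ∞ N) (hz : z ∈ e.target) (i j : Fin n) :
    ContDiffAt ℝ ∞ (secondFF e ι i j) z := by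
  have h : secondFF e ι i j =ᶠ[nhds z]
      fun w => pd i (pdEmb e ι j) w - ∑ m, christoffel g e m i j w • pdEmb e ι m w := by
    filter_upwards [eventually_mem_target hz] with w hw
    rw [hι.pd_pdEmb he hw, add_sub_cancel_left]
  refine ContDiffAt.congr_of_eventuallyEq ?_ h
  exact (contDiffAt_pd (hι.contDiffAt_pdEmb he hz j) i).sub (ContDiffAt.sum fun m _ =>
    (hι.contDiffAt_christoffel he hz m i j).smul (hι.contDiffAt_pdEmb he hz m))

/-- The Weingarten relation. -/
lemma IsIsometricEmbedding.inner_pd_secondFF_pdEmb (hι : IsIsometricEmbedding g ι)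
    (he : e ∈ IsManifold.maximalAtlas (𝓡 n) ∞ N) (hz : z ∈ e.target) (p i j k : Fin n) :
    ⟪pd p (secondFF e ι i j) z, pdEmb e ι k z⟫_ℝ =
      -⟪secondFF e ι i j z, secondFF e ι p k z⟫_ℝ := by
  have h := pd_inner ((hι.contDiffAt_secondFF he hz i j).differentiableAt (by simp))
    ((hι.contDiffAt_pdEmb he hz k).differentiableAt (by simp)) p
  simp only [inner_secondFF_pdEmb] at h
  rw [hι.pd_pdEmb he hz, inner_add_right, inner_sum] at h
  simp only [inner_smul_right, inner_secondFF_pdEmb, mul_zero, Finset.sum_const_zero,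
    zero_add] at h
  -- After the simplification above, the left side of `h` is the derivative of the constant function
  -- 0 = ⟨II_ij, X_k⟩.
  have h0 : pd p (fun _ : EuclideanSpace ℝ (Fin n) => (0 : ℝ)) z = 0 := by simp [pd]
  linarith

lemma IsIsometricEmbedding.pd_pd_pdEmb (hι : IsIsometricEmbedding g ι)
    (he : e ∈ IsManifold.maximalAtlas (𝓡 n) ∞ N) (hz : z ∈ e.target) (p i j : Fin n) :
    pd p (pd i (pdEmb e ι j)) z =
      ∑ m, (christoffel g e m i j z • pd p (pdEmb e ι m) z +
        pd p (christoffel g e m i j) z • pdEmb e ι m z) + pd p (secondFF e ι i j) z := by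
  have hΓ := fun m => (hι.contDiffAt_christoffel he hz m i j).differentiableAt (by simp)
  have hX := fun m => (hι.contDiffAt_pdEmb he hz m).differentiableAt (by simp)
  rw [← pd_sum_smul hΓ hX p, ← pd_add _
    ((hι.contDiffAt_secondFF he hz i j).differentiableAt (by simp))]
  · refine pd_congr ?_ p
    filter_upwards [eventually_mem_target hz] with w hw using hι.pd_pdEmb he hw i j
  · exact DifferentiableAt.fun_sum fun m _ => (hΓ m).fun_smul (hX m)

/-- The Gauss equation. -/
lemma IsIsometricEmbedding.curvLow_eq (hι : IsIsometricEmbedding g ι)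
    (he : e ∈ IsManifold.maximalAtlas (𝓡 n) ∞ N) (hz : z ∈ e.target) (p l i j : Fin n) :
    curvLow g e p l i j z =
      ⟪secondFF e ι i p z, secondFF e ι j l z⟫_ℝ - ⟪secondFF e ι j p z, secondFF e ι i l z⟫_ℝ := by
  -- The tangential part of ∂_i ∂_j X_l consists of the ∂Γ + ΓΓ terms of the curvature and a
  -- Weingarten term. Swapping i and j leaves the left side unchanged, so the difference of the two
  -- expansions is the Gauss equation.
  have key : ∀ i j, ⟪pd i (pd j (pdEmb e ι l)) z, pdEmb e ι p z⟫_ℝ =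
      ∑ m, metricMatrix g e z p m * (pd i (christoffel g e m j l) z
        + ∑ k, christoffel g e m i k z * christoffel g e k j l z)
        - ⟪secondFF e ι i p z, secondFF e ι j l z⟫_ℝ := by
    intro i j
    have h1 : ∀ k, ⟪pd i (pdEmb e ι k) z, pdEmb e ι p z⟫_ℝ =
        ∑ m, christoffel g e m i k z * metricMatrix g e z p m := by
      intro k
      rw [hι.pd_pdEmb he hz, inner_add_left, inner_secondFF_pdEmb, add_zero, sum_inner]
      refine Finset.sum_congr rfl fun m _ => ?_
      rw [inner_smul_left, hι.metricMatrix_apply he hz, real_inner_comm]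
      rfl
    rw [hι.pd_pd_pdEmb he hz, inner_add_left, hι.inner_pd_secondFF_pdEmb he hz, sum_inner,
      real_inner_comm (secondFF e ι j l z), sub_eq_add_neg]
    congr 1
    simp only [inner_add_left, inner_smul_left, conj_trivial, h1, Finset.sum_add_distrib,
      mul_add, Finset.mul_sum]
    rw [add_comm]
    congr 1
    · refine Finset.sum_congr rfl fun m _ => ?_
      rw [mul_comm, hι.metricMatrix_apply he hz, real_inner_comm]
    · rw [Finset.sum_comm]
      exact Finset.sum_congr rfl fun m _ => Finset.sum_congr rfl fun k _ => by ring
  have h := pd_comm (hι.contDiffAt_pdEmb he hz l) i j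
  have h2 := key i j
  rw [h, key j i] at h2
  simp only [curvLow, curvUp]
  simp only [Finset.sum_sub_distrib, mul_add, mul_sub, Finset.sum_add_distrib] at h2 ⊢
  linarith

end TargetGeometry

/-! ### Curvature and its covariant derivative through II; comparison of tangential coefficients. -/

section TargetGeometry

variable {n : ℕ} {N : Type*} [TopologicalSpace N] [ChartedSpace (EuclideanSpace ℝ (Fin n)) N]
  [IsManifold (𝓡 n) ∞ N] {g : Metric n N} {e : OpenPartialHomeomorph N (EuclideanSpace ℝ (Fin n))}
  {q : ℕ} {ι : N → EuclideanSpace ℝ (Fin q)} {z : EuclideanSpace ℝ (Fin n)}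

lemma IsIsometricEmbedding.curvUp_eq (hι : IsIsometricEmbedding g ι)
    (he : e ∈ IsManifold.maximalAtlas (𝓡 n) ∞ N) (hz : z ∈ e.target) (m l i j : Fin n) :
    curvUp g e m l i j z = ∑ p, invMetric g e z m p *
      (⟪secondFF e ι i p z, secondFF e ι j l z⟫_ℝ
        - ⟪secondFF e ι j p z, secondFF e ι i l z⟫_ℝ) := by
  simp only [← hι.curvLow_eq he hz, curvLow, Finset.mul_sum, ← mul_assoc]
  rw [Finset.sum_comm]
  simp only [← Finset.sum_mul, hι.sum_invMetric_mul_metricMatrix he hz]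
  simp

/-- Product rule for the Gauss equation, which holds on a neighbourhood. The Christoffel corrections
of ∇R distribute exactly over those of the four factors ∇II. -/
lemma IsIsometricEmbedding.covCurv_eq (hι : IsIsometricEmbedding g ι)
    (he : e ∈ IsManifold.maximalAtlas (𝓡 n) ∞ N) (hz : z ∈ e.target) (p i j k l : Fin n) :
    covCurv g e p i j k l z =
      ⟪covSecondFF g e ι p i k z, secondFF e ι j l z⟫_ℝ
      + ⟪covSecondFF g e ι p j l z, secondFF e ι i k z⟫_ℝ
      - ⟪covSecondFF g e ι p i l z, secondFF e ι j k z⟫_ℝ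
      - ⟪covSecondFF g e ι p j k z, secondFF e ι i l z⟫_ℝ := by
  have hII := fun i j => (hι.contDiffAt_secondFF he hz i j).differentiableAt (by simp)
  have h1 : pd p (curvLow g e i j k l) z =
      pd p (fun w => ⟪secondFF e ι i k w, secondFF e ι j l w⟫_ℝ
        - ⟪secondFF e ι i l w, secondFF e ι j k w⟫_ℝ) z := by
    refine pd_congr ?_ p
    filter_upwards [eventually_mem_target hz] with w hw
    rw [hι.curvLow_eq he hw, hι.secondFF_symm he hw k i, hι.secondFF_symm he hw l j,
      hι.secondFF_symm he hw l i, hι.secondFF_symm he hw k j]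
  rw [pd_sub ((hII _ _).inner ℝ (hII _ _)) ((hII _ _).inner ℝ (hII _ _)),
    pd_inner (hII _ _) (hII _ _), pd_inner (hII _ _) (hII _ _)] at h1
  simp only [covCurv, h1, covSecondFF, inner_sub_left, inner_normalProj_secondFF, sum_inner,
    inner_add_left, inner_smul_left, conj_trivial, hι.curvLow_eq he hz]
  rw [real_inner_comm (pd p (secondFF e ι j l) z), real_inner_comm (pd p (secondFF e ι j k) z)]
  -- A, B, C, D are the products containing a derivative of II; S is the Christoffel part of ∇R, and
  -- S1 to S4 are those of the four ∇II terms. Only the identity for S then remains to be checked.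
  have : ∀ A B C D S S1 S2 S3 S4 : ℝ, S = S1 + S2 - S3 - S4 →
      A + B - (C + D) - S = (B - S1) + (A - S2) - (D - S3) - (C - S4) := by intros; linarith
  apply this
  simp only [← Finset.sum_add_distrib, ← Finset.sum_sub_distrib]
  refine Finset.sum_congr rfl fun s _ => ?_
  rw [hι.secondFF_symm he hz k s, hι.secondFF_symm he hz l s, hι.secondFF_symm he hz k i,
    hι.secondFF_symm he hz l i, hι.secondFF_symm he hz k j, hι.secondFF_symm he hz l j,
    hι.secondFF_symm he hz s i, hι.secondFF_symm he hz s j,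
    real_inner_comm (secondFF e ι i k z) (secondFF e ι j s z),
    real_inner_comm (secondFF e ι i k z) (secondFF e ι s l z),
    real_inner_comm (secondFF e ι i l z) (secondFF e ι j s z),
    real_inner_comm (secondFF e ι i l z) (secondFF e ι s k z)]
  ring

/-- The coordinate vector fields are linearly independent, with coefficients in any real vector
space. -/
lemma IsIsometricEmbedding.sum_pdEmb_smul_eq_iff {V : Type*} [AddCommGroup V] [Module ℝ V]
    (hι : IsIsometricEmbedding g ι)
    (he : e ∈ IsManifold.maximalAtlas (𝓡 n) ∞ N) (hz : z ∈ e.target) (v w : Fin n → V) :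
    (∀ B, ∑ m, pdEmb e ι m z B • v m = ∑ m, pdEmb e ι m z B • w m) ↔ ∀ m, v m = w m := by
  refine ⟨fun h => ?_, fun h B => by simp [h]⟩
  -- An explicit left inverse: pairing with X_p over the ambient index B yields g_pm u^m, and
  -- contracting with g^{rp} recovers u^r.
  have key : ∀ (u : Fin n → V) r, ∑ p, invMetric g e z r p •
      ∑ B, pdEmb e ι p z B • ∑ m, pdEmb e ι m z B • u m = u r := by
    intro u r
    have : ∀ p, ∑ B, pdEmb e ι p z B • ∑ m, pdEmb e ι m z B • u m =
        ∑ m, metricMatrix g e z p m • u m := by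
      intro p
      simp only [Finset.smul_sum]
      rw [Finset.sum_comm]
      refine Finset.sum_congr rfl fun m _ => ?_
      simp only [smul_smul, ← Finset.sum_smul, hι.metricMatrix_apply he hz]
      simp [PiLp.inner_apply, mul_comm]
    rw [Finset.sum_congr rfl fun p _ => congrArg (invMetric g e z r p • ·) (this p)]
    simp only [Finset.smul_sum, smul_smul]
    rw [Finset.sum_comm]
    simp only [← Finset.sum_smul, hι.sum_invMetric_mul_metricMatrix he hz]
    simp
  intro m
  rw [← key v m, ← key w m]
  simp only [h]

end TargetGeometry

/-! ### Calculus of derivatives along vector fields on the surface. -/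

section Surface

variable {M : Type*} [TopologicalSpace M] [ChartedSpace (EuclideanSpace ℝ (Fin 2)) M]
  {V : Type*} [NormedAddCommGroup V] [NormedSpace ℝ V]
  {X : (x : M) → TangentSpace (𝓡 2) x} {x : M}

lemma deriveAlong_congr {f f' : M → V} (h : f =ᶠ[nhds x] f') :
    deriveAlong X f x = deriveAlong X f' x := by
  simp only [deriveAlong, h.mfderiv_eq]
  rfl

lemma deriveAlong_smul {c : M → ℝ} {f : M → V} (hc : MDifferentiableAt (𝓡 2) 𝓘(ℝ, ℝ) c x)
    (hf : MDifferentiableAt (𝓡 2) 𝓘(ℝ, V) f x) :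
    deriveAlong X (fun w => c w • f w) x =
      c x • deriveAlong X f x + deriveAlong X c x • f x := by
  have := congrArg (fun T => T (X x)) (mvfderiv_fun_smul hc hf)
  simp at this
  exact this

lemma deriveAlong_sum {κ : Type*} (s : Finset κ) {f : κ → M → V}
    (hf : ∀ i ∈ s, MDifferentiableAt (𝓡 2) 𝓘(ℝ, V) (f i) x) :
    deriveAlong X (fun w => ∑ i ∈ s, f i w) x = ∑ i ∈ s, deriveAlong X (f i) x := by
  classical
  have key : ∀ t ⊆ s, MDifferentiableAt (𝓡 2) 𝓘(ℝ, V) (fun w => ∑ i ∈ t, f i w) x ∧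
      deriveAlong X (fun w => ∑ i ∈ t, f i w) x = ∑ i ∈ t, deriveAlong X (f i) x := by
    intro t
    induction t using Finset.induction_on with
    | empty =>
      intro _
      simp only [Finset.sum_empty]
      refine ⟨mdifferentiableAt_const, ?_⟩
      have := congrArg (fun T => T (X x)) (mvfderiv_const (I := 𝓡 2) (𝕜 := ℝ) (0 : V) (x := x))
      exact this
    | insert i t hi ih =>
      intro hts
      obtain ⟨h1, h2⟩ := ih fun j hj => hts (Finset.mem_insert_of_mem hj)
      have hfi := hf i (hts (Finset.mem_insert_self i t))
      simp only [Finset.sum_insert hi, ← h2]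
      refine ⟨hfi.add h1, ?_⟩
      have := congrArg (fun T => T (X x)) (mvfderiv_fun_add hfi h1)
      exact this
  exact (key s subset_rfl).2

lemma deriveAlong_comp {W : Type*} [NormedAddCommGroup W] [NormedSpace ℝ W] {F : W → V}
    {p : M → W} (hF : DifferentiableAt ℝ F (p x)) (hp : MDifferentiableAt (𝓡 2) 𝓘(ℝ, W) p x) :
    deriveAlong X (fun w => F (p w)) x = fderiv ℝ F (p x) (deriveAlong X p x) := by
  have h := mfderiv_comp x hF.mdifferentiableAt hp
  rw [mfderiv_eq_fderiv] at h
  exact congrArg (fun T => T (X x)) h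

lemma deriveAlong_comp_eq_sum {n : ℕ} {F : EuclideanSpace ℝ (Fin n) → V}
    {p : M → EuclideanSpace ℝ (Fin n)} (hF : DifferentiableAt ℝ F (p x))
    (hp : MDifferentiableAt (𝓡 2) (𝓡 n) p x) :
    deriveAlong X (fun w => F (p w)) x =
      ∑ i, deriveAlong X (fun w => p w i) x • pd i F (p x) := by
  have h : ∀ i, deriveAlong X (fun w => p w i) x = (deriveAlong X p x) i := by
    intro i
    rw [deriveAlong_comp (F := fun v : EuclideanSpace ℝ (Fin n) => v i)
      (EuclideanSpace.proj (𝕜 := ℝ) i).differentiableAt hp]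
    exact congrArg (fun T => T (deriveAlong X p x)) (EuclideanSpace.proj (𝕜 := ℝ) i).fderiv
  rw [deriveAlong_comp hF hp]
  have hv : deriveAlong X p x = ∑ i, (deriveAlong X p x) i • EuclideanSpace.single i (1 : ℝ) := by
    ext j; simp [Finset.sum_apply, Pi.single_apply]
  conv_lhs => rw [hv, map_sum]
  simp [pd, h]

/-- The derivative is the fibre component of the tangent map of f composed with the section X; on an
open set the derivative within the set is the ordinary one. -/
lemma contMDiffOn_deriveAlong [IsManifold (𝓡 2) ∞ M] {W : Set M} (hW : IsOpen W) {f : M → V}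
    (hf : ContMDiffOn (𝓡 2) 𝓘(ℝ, V) ∞ f W)
    (hX : ContMDiffOn (𝓡 2) (𝓡 2).tangent ∞
      (fun x => (⟨x, X x⟩ : TangentBundle (𝓡 2) M)) W) :
    ContMDiffOn (𝓡 2) 𝓘(ℝ, V) ∞ (deriveAlong X f) W := by
  have : IsManifold (𝓡 2) 1 M := IsManifold.of_le (n := ∞) (by simp)
  have h1 := hf.contMDiffOn_tangentMapWithin (m := ∞) (by simp) hW.uniqueMDiffOn
  have h2 := h1.comp hX fun y hy => hy
  have h3 := (contMDiff_snd_tangentBundle_modelSpace V 𝓘(ℝ, V) (n := ∞)).comp_contMDiffOn h2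
  refine h3.congr fun y hy => ?_
  change deriveAlong X f y = mfderivWithin (𝓡 2) 𝓘(ℝ, V) f W y (X y)
  rw [mfderivWithin_of_isOpen hW hy]
  rfl

end Surface

/-! ### The map equation: derivatives of ι ∘ φ through those of φ. -/

section Composition

variable {M : Type*} [TopologicalSpace M] [ChartedSpace (EuclideanSpace ℝ (Fin 2)) M]
  [IsManifold (𝓡 2) ∞ M] {h : Metric 2 M} {A : Type*} {σ : SpinStructure h A}
  {n : ℕ} {N : Type*} [TopologicalSpace N] [ChartedSpace (EuclideanSpace ℝ (Fin n)) N]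
  [IsManifold (𝓡 n) ∞ N] {g : Metric n N} {e : OpenPartialHomeomorph N (EuclideanSpace ℝ (Fin n))}
  {q : ℕ} {ι : N → EuclideanSpace ℝ (Fin q)} {φ : M → N} {a : A} {x : M}

omit [IsManifold (𝓡 2) ∞ M] [IsManifold (𝓡 n) ∞ N] in
lemma contMDiffOn_chart_comp (he : e ∈ IsManifold.maximalAtlas (𝓡 n) ∞ N)
    (hφ : ContMDiff (𝓡 2) (𝓡 n) ∞ φ) :
    ContMDiffOn (𝓡 2) (𝓡 n) ∞ (fun w => e (φ w)) (φ ⁻¹' e.source) :=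
  (contMDiffOn_of_mem_maximalAtlas he).comp hφ.contMDiffOn fun _ hy => hy

omit [ChartedSpace (EuclideanSpace ℝ (Fin 2)) M] [IsManifold (𝓡 2) ∞ M]
  [ChartedSpace (EuclideanSpace ℝ (Fin n)) N] [IsManifold (𝓡 n) ∞ N] in
lemma eventually_mem_source (hφ : Continuous φ) (hxe : φ x ∈ e.source) :
    ∀ᶠ w in nhds x, φ w ∈ e.source :=
  (e.open_source.preimage hφ).mem_nhds hxe

omit [IsManifold (𝓡 2) ∞ M] [IsManifold (𝓡 n) ∞ N] in
lemma mdifferentiableAt_chart_comp (he : e ∈ IsManifold.maximalAtlas (𝓡 n) ∞ N)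
    (hφ : ContMDiff (𝓡 2) (𝓡 n) ∞ φ) (hxe : φ x ∈ e.source) :
    MDifferentiableAt (𝓡 2) (𝓡 n) (fun w => e (φ w)) x :=
  ((contMDiffAt_of_mem_maximalAtlas he hxe).comp x hφ.contMDiffAt).mdifferentiableAt (by simp)

omit [IsManifold (𝓡 n) ∞ N] in
lemma mdifferentiableAt_dmap (he : e ∈ IsManifold.maximalAtlas (𝓡 n) ∞ N)
    (hφ : ContMDiff (𝓡 2) (𝓡 n) ∞ φ) (hxa : x ∈ σ.U a) (hxe : φ x ∈ e.source)
    (i : Fin n) (α : Fin 2) :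
    MDifferentiableAt (𝓡 2) 𝓘(ℝ, ℝ) (dmap σ φ e a i α) x := by
  have hW : IsOpen (σ.U a ∩ φ ⁻¹' e.source) :=
    (σ.isOpen_U a).inter (e.open_source.preimage hφ.continuous)
  have hp : ContMDiffOn (𝓡 2) 𝓘(ℝ, ℝ) ∞ (fun w => e (φ w) i) (σ.U a ∩ φ ⁻¹' e.source) :=
    ((EuclideanSpace.proj (𝕜 := ℝ) i).contDiff.contMDiff (n := ∞)).comp_contMDiffOn
      ((contMDiffOn_chart_comp he hφ).mono Set.inter_subset_right)
  exact ((contMDiffOn_deriveAlong hW hp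
    ((σ.smooth_frame a α).mono Set.inter_subset_left)).contMDiffAt
      (hW.mem_nhds ⟨hxa, hxe⟩)).mdifferentiableAt (by simp)

omit [IsManifold (𝓡 n) ∞ N] in
lemma deriveAlong_comp_chart (he : e ∈ IsManifold.maximalAtlas (𝓡 n) ∞ N)
    (hφ : ContMDiff (𝓡 2) (𝓡 n) ∞ φ) (hxe : φ x ∈ e.source)
    {V : Type*} [NormedAddCommGroup V] [NormedSpace ℝ V] {F : EuclideanSpace ℝ (Fin n) → V}
    (hF : DifferentiableAt ℝ F (e (φ x))) (α : Fin 2) :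
    deriveAlong (σ.frame a α) (fun w => F (e (φ w))) x =
      ∑ i, dmap σ φ e a i α x • pd i F (e (φ x)) :=
  deriveAlong_comp_eq_sum (p := fun w => e (φ w)) hF (mdifferentiableAt_chart_comp he hφ hxe)

lemma IsIsometricEmbedding.deriveAlong_comp_map (hι : IsIsometricEmbedding g ι)
    (he : e ∈ IsManifold.maximalAtlas (𝓡 n) ∞ N)
    (hφ : ContMDiff (𝓡 2) (𝓡 n) ∞ φ) (hxe : φ x ∈ e.source) (α : Fin 2) :
    deriveAlong (σ.frame a α) (fun w => ι (φ w)) x =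
      ∑ i, dmap σ φ e a i α x • pdEmb e ι i (e (φ x)) := by
  refine Eq.trans ?_ (deriveAlong_comp_chart (F := fun w => ι (e.symm w)) he hφ hxe
    ((hι.contDiffAt_comp_symm he (e.map_source hxe)).differentiableAt (by simp)) α)
  refine deriveAlong_congr ?_
  filter_upwards [eventually_mem_source hφ.continuous hxe] with w hw
  rw [e.left_inv hw]

/-- The Laplacian of `ι ∘ φ` in terms of the tension field of `φ`. -/
lemma IsIsometricEmbedding.neg_laplacian_comp (hι : IsIsometricEmbedding g ι)
    (he : e ∈ IsManifold.maximalAtlas (𝓡 n) ∞ N)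
    (hφ : ContMDiff (𝓡 2) (𝓡 n) ∞ φ) (hxa : x ∈ σ.U a) (hxe : φ x ∈ e.source) :
    -σ.laplacian a (fun w => ι (φ w)) x =
      ∑ m, tension σ φ g e a m x • pdEmb e ι m (e (φ x)) + termII σ φ e ι a x := by
  have hz := e.map_source hxe
  have hX := fun i => (hι.contDiffAt_pdEmb he hz i).differentiableAt (by simp)
  have hd := mdifferentiableAt_dmap (σ := σ) he hφ hxa hxe
  have hXp : ∀ i, MDifferentiableAt (𝓡 2) (𝓡 q) (fun w => pdEmb e ι i (e (φ w))) x :=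
    fun i => (hX i).mdifferentiableAt.comp x (mdifferentiableAt_chart_comp he hφ hxe)
  have h2 : ∀ α, deriveAlong (σ.frame a α) (deriveAlong (σ.frame a α) fun w => ι (φ w)) x =
      ∑ m, (deriveAlong (σ.frame a α) (dmap σ φ e a m α) x
        + ∑ i, ∑ j, christoffel g e m i j (e (φ x)) * dmap σ φ e a i α x * dmap σ φ e a j α x)
          • pdEmb e ι m (e (φ x))
      + ∑ i, ∑ j, (dmap σ φ e a i α x * dmap σ φ e a j α x) • secondFF e ι i j (e (φ x)) := by
    intro α
    -- The first derivative is needed on a whole neighbourhood, since it is differentiated once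
    -- more.
    have hcongr : (deriveAlong (σ.frame a α) fun w => ι (φ w)) =ᶠ[nhds x]
        fun w => ∑ i, dmap σ φ e a i α w • pdEmb e ι i (e (φ w)) := by
      filter_upwards [eventually_mem_source hφ.continuous hxe] with w hw
      exact hι.deriveAlong_comp_map he hφ hw α
    rw [deriveAlong_congr hcongr, deriveAlong_sum (f := fun i w =>
      dmap σ φ e a i α w • pdEmb e ι i (e (φ w))) _ fun i _ => (hd i α).smul (hXp i)]
    have h3 : ∑ m, ∑ i, ∑ j, (christoffel g e m i j (e (φ x)) * dmap σ φ e a i α x *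
        dmap σ φ e a j α x) • pdEmb e ι m (e (φ x)) =
        ∑ i, ∑ j, ∑ m, (christoffel g e m i j (e (φ x)) * dmap σ φ e a i α x *
        dmap σ φ e a j α x) • pdEmb e ι m (e (φ x)) :=
      Finset.sum_comm.trans (Finset.sum_congr rfl fun i _ => Finset.sum_comm)
    simp only [add_smul, Finset.sum_add_distrib, Finset.sum_smul, h3]
    rw [add_assoc, ← Finset.sum_add_distrib, ← Finset.sum_add_distrib]
    refine Finset.sum_congr rfl fun i _ => ?_
    rw [deriveAlong_smul (hd i α) (hXp i), deriveAlong_comp_chart he hφ hxe (hX i), add_comm,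
      ← Finset.sum_add_distrib, Finset.smul_sum]
    congr 1
    refine Finset.sum_congr rfl fun j _ => ?_
    rw [hι.pd_pdEmb he hz, hι.secondFF_symm he hz j i, smul_add, smul_add, smul_smul, smul_smul,
      Finset.smul_sum]
    congr 1
    refine Finset.sum_congr rfl fun m _ => ?_
    rw [hι.christoffel_symm he hz m j i, smul_smul]
    congr 1
    ring
  -- The ∇_{e_α} e_α correction involves only first derivatives of ι ∘ φ, hence is tangential; it
  -- supplies the first-order part of the Laplacian inside τ^m.
  simp only [SpinStructure.laplacian, tension, neg_neg, termII, h2,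
    hι.deriveAlong_comp_map he hφ hxe, ← Finset.sum_add_distrib, Finset.sum_smul]
  rw [Finset.sum_comm (s := Finset.univ (α := Fin n)), ← Finset.sum_add_distrib]
  refine Finset.sum_congr rfl fun α _ => ?_
  rw [Finset.sum_add_distrib, add_sub_right_comm]
  congr 1
  simp only [Finset.smul_sum]
  rw [Finset.sum_comm (s := Finset.univ (α := Fin 2)), ← Finset.sum_sub_distrib]
  refine Finset.sum_congr rfl fun m _ => ?_
  simp only [smul_smul, ← Finset.sum_smul, ← sub_smul]
  congr 1
  rw [sub_add_eq_add_sub]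
  rfl

end Composition

/-! ### Contraction of vector spinors with linear forms. -/

section Contraction

variable {T : Type*} [AddCommGroup T] [Module ℝ T]

lemma contract_tmul (ℓ : T →ₗ[ℝ] ℝ) (s : Spinor) (t : T) :
    contract ℓ (s ⊗ₜ[ℝ] t) = ℓ t • s := by
  simp [contract]

lemma contract_sum_smul {κ : Type*} [Fintype κ] (c : κ → ℝ) (ℓ : κ → T →ₗ[ℝ] ℝ)
    (v : Spinor ⊗[ℝ] T) :
    contract (∑ i, c i • ℓ i) v = ∑ i, c i • contract (ℓ i) v := by
  induction v with
  | zero => simp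
  | tmul => simp [contract_tmul, Finset.sum_smul, smul_smul]
  | add _ _ hu hv => simp [hu, hv, Finset.sum_add_distrib]

end Contraction

lemma sum_comm_outer_inner {κ₁ κ₂ κ₃ κ₄ V : Type*} [Fintype κ₁] [Fintype κ₂] [Fintype κ₃]
    [Fintype κ₄] [AddCommMonoid V] (f : κ₁ → κ₂ → κ₃ → κ₄ → V) :
    ∑ i, ∑ j, ∑ k, ∑ l, f i j k l = ∑ l, ∑ j, ∑ k, ∑ i, f i j k l := by
  rw [Finset.sum_comm, Finset.sum_comm (s := Finset.univ (α := κ₄))]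
  refine Finset.sum_congr rfl fun j _ => ?_
  rw [Finset.sum_comm, Finset.sum_comm (s := Finset.univ (α := κ₄))]
  exact Finset.sum_congr rfl fun k _ => Finset.sum_comm

lemma cliff_smul (α : Fin 2) (r : ℝ) (χ : Spinor) : cliff α (r • χ) = r • cliff α χ :=
  LinearMap.map_smul_of_tower _ _ _

/-! ### The spinor equation: Leibniz rules and the Dirac operator of the ambient spinors. -/

section SpinorFields

variable {M : Type*} [TopologicalSpace M] [ChartedSpace (EuclideanSpace ℝ (Fin 2)) M]
  [IsManifold (𝓡 2) ∞ M] {h : Metric 2 M} {A : Type*} {σ : SpinStructure h A}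
  {a : A} {x : M}

lemma SpinStructure.dirac_congr {χ χ' : M → Spinor} (hχ : χ =ᶠ[nhds x] χ') :
    σ.dirac a χ x = σ.dirac a χ' x := by
  simp only [SpinStructure.dirac, SpinStructure.spinConn, deriveAlong_congr hχ, hχ.eq_of_nhds]

/-- The Leibniz rule for the spin connection. -/
lemma SpinStructure.spinConn_sum_smul {κ : Type*} [Fintype κ] {c : κ → M → ℝ}
    {χ : κ → M → Spinor} (hc : ∀ i, MDifferentiableAt (𝓡 2) 𝓘(ℝ, ℝ) (c i) x)
    (hχ : ∀ i, MDifferentiableAt (𝓡 2) 𝓘(ℝ, Spinor) (χ i) x) (α : Fin 2) :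
    σ.spinConn a α (fun w => ∑ i, c i w • χ i w) x =
      ∑ i, (c i x • σ.spinConn a α (χ i) x + deriveAlong (σ.frame a α) (c i) x • χ i x) := by
  simp only [SpinStructure.spinConn]
  rw [deriveAlong_sum (f := fun i w => c i w • χ i w) _ fun i _ => (hc i).smul (hχ i)]
  simp only [deriveAlong_smul (hc _) (hχ _), smul_add, Finset.sum_add_distrib, map_sum, cliff_smul]
  rw [add_right_comm]
  congr 2
  simp only [Finset.smul_sum]
  rw [Finset.sum_congr rfl fun β _ => Finset.sum_comm, Finset.sum_comm]
  refine Finset.sum_congr rfl fun i _ => Finset.sum_congr rfl fun β _ =>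
    Finset.sum_congr rfl fun γ _ => ?_
  simp only [smul_smul]
  congr 1
  ring

/-- The Leibniz rule for the Dirac operator. -/
lemma SpinStructure.dirac_sum_smul {κ : Type*} [Fintype κ] {c : κ → M → ℝ}
    {χ : κ → M → Spinor} (hc : ∀ i, MDifferentiableAt (𝓡 2) 𝓘(ℝ, ℝ) (c i) x)
    (hχ : ∀ i, MDifferentiableAt (𝓡 2) 𝓘(ℝ, Spinor) (χ i) x) :
    σ.dirac a (fun w => ∑ i, c i w • χ i w) x =
      ∑ i, (c i x • σ.dirac a (χ i) x
        + ∑ α, deriveAlong (σ.frame a α) (c i) x • cliff α (χ i x)) := by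
  simp only [SpinStructure.dirac, SpinStructure.spinConn_sum_smul hc hχ, map_sum, map_add,
    cliff_smul, Finset.smul_sum, ← Finset.sum_add_distrib]
  exact Finset.sum_comm

variable {n : ℕ} {N : Type*} [TopologicalSpace N] [ChartedSpace (EuclideanSpace ℝ (Fin n)) N]
  [IsManifold (𝓡 n) ∞ N] {g : Metric n N} {e : OpenPartialHomeomorph N (EuclideanSpace ℝ (Fin n))}
  {q : ℕ} {ι : N → EuclideanSpace ℝ (Fin q)} {φ : M → N} {ψ : VectorSpinor (n := n) σ φ}

/-- Chain rule for ι = (ι ∘ e⁻¹) ∘ e near y, that is dι^B = X_i^B dyⁱ. Contracting ψ with both sides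
expresses the ambient spinors through the ψⁱ. -/
lemma IsIsometricEmbedding.diffAt_apply (hι : IsIsometricEmbedding g ι)
    (he : e ∈ IsManifold.maximalAtlas (𝓡 n) ∞ N) {y : N} (hy : y ∈ e.source) (B : Fin q) :
    diffAt (n := n) (fun y => ι y B) y = ∑ i, pdEmb e ι i (e y) B • diffAt (fun y => e y i) y := by
  have hz := e.map_source hy
  have hu := (hι.contDiffAt_comp_symm he hz).differentiableAt (by simp)
  have hed : MDifferentiableAt (𝓡 n) (𝓡 n) e y :=
    (contMDiffAt_of_mem_maximalAtlas he hy).mdifferentiableAt (by simp)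
  have hproj : ∀ (k : ℕ) (i : Fin k) (f : N → EuclideanSpace ℝ (Fin k)),
      MDifferentiableAt (𝓡 n) (𝓡 k) f y → ∀ v,
      mfderiv (𝓡 n) 𝓘(ℝ, ℝ) (fun y => f y i) y v =
        EuclideanSpace.proj (𝕜 := ℝ) i (mfderiv (𝓡 n) (𝓡 k) f y v) := by
    intro k i f hf v
    have h := mfderiv_comp y
      ((EuclideanSpace.proj (𝕜 := ℝ) i).differentiableAt (x := f y)).mdifferentiableAt hf
    rw [mfderiv_eq_fderiv, ContinuousLinearMap.fderiv] at h
    exact congrArg (fun T => T v) h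
  ext v
  have h1 : mfderiv (𝓡 n) (𝓡 q) ι y v = fderiv ℝ (fun w => ι (e.symm w)) (e y)
      (mfderiv (𝓡 n) (𝓡 n) e y v) := by
    have h2 : ι =ᶠ[nhds y] (fun w => ι (e.symm w)) ∘ e := by
      filter_upwards [e.open_source.mem_nhds hy] with w hw
      simp [e.left_inv hw]
    have h := mfderiv_comp y hu.mdifferentiableAt hed
    rw [mfderiv_eq_fderiv, ← h2.mfderiv_eq] at h
    exact congrArg (fun T => T v) h
  -- D is the image of v under the differential of the chart, retyped as a Euclidean vector so that
  -- its coordinates can be taken.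
  obtain ⟨D, hD⟩ : ∃ D : EuclideanSpace ℝ (Fin n), D = mfderiv (𝓡 n) (𝓡 n) e y v := ⟨_, rfl⟩
  have hv : D = ∑ i, D i • EuclideanSpace.single i (1 : ℝ) := by
    ext j; simp [Finset.sum_apply, Pi.single_apply]
  have hL : diffAt (n := n) (fun y => ι y B) y v =
      (fderiv ℝ (fun w => ι (e.symm w)) (e y) D) B := by
    refine (hproj q B ι (hι.contMDiff.mdifferentiableAt (by simp)) v).trans ?_
    rw [h1, hD]
    rfl
  have hR : ∀ i, diffAt (n := n) (fun y => e y i) y v = D i := by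
    intro i
    refine (hproj n i e hed v).trans ?_
    rw [← hD]
    rfl
  rw [hL, hv, map_sum]
  simp [hR, pdEmb, pd, mul_comm]

lemma IsIsometricEmbedding.ambient_eq (hι : IsIsometricEmbedding g ι)
    (he : e ∈ IsManifold.maximalAtlas (𝓡 n) ∞ N) (hxe : φ x ∈ e.source) (B : Fin q) :
    ψ.ambient ι a B x = ∑ i, pdEmb e ι i (e (φ x)) B • ψ.comp e a i x := by
  rw [VectorSpinor.ambient, hι.diffAt_apply he hxe, contract_sum_smul]
  rfl

omit [IsManifold (𝓡 n) ∞ N] in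
lemma VectorSpinor.mdifferentiableAt_comp (he : e ∈ IsManifold.maximalAtlas (𝓡 n) ∞ N)
    (hφ : ContMDiff (𝓡 2) (𝓡 n) ∞ φ) (hxa : x ∈ σ.U a) (hxe : φ x ∈ e.source) (i : Fin n) :
    MDifferentiableAt (𝓡 2) 𝓘(ℝ, Spinor) (ψ.comp e a i) x :=
  ((ψ.smooth a e he i).contMDiffAt (((σ.isOpen_U a).inter
    (e.open_source.preimage hφ.continuous)).mem_nhds ⟨hxa, hxe⟩)).mdifferentiableAt (by simp)

/-- The Dirac operator of the ambient spinors in terms of the twisted Dirac operator. -/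
lemma IsIsometricEmbedding.dirac_ambient (hι : IsIsometricEmbedding g ι)
    (he : e ∈ IsManifold.maximalAtlas (𝓡 n) ∞ N)
    (hφ : ContMDiff (𝓡 2) (𝓡 n) ∞ φ) (hxa : x ∈ σ.U a) (hxe : φ x ∈ e.source) (B : Fin q) :
    σ.dirac a (ψ.ambient ι a B) x =
      ∑ m, pdEmb e ι m (e (φ x)) B • twistedDirac ψ g e a m x + termIISpinor ψ e ι a B x := by
  have hz := e.map_source hxe
  have hX := fun i => (hι.contDiffAt_pdEmb he hz i).differentiableAt (by simp)
  have hXB : ∀ i, DifferentiableAt ℝ (fun z => pdEmb e ι i z B) (e (φ x)) :=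
    fun i => (EuclideanSpace.proj (𝕜 := ℝ) B).differentiableAt.comp _ (hX i)
  have hpdB : ∀ i j, pd j (fun z => pdEmb e ι i z B) (e (φ x)) =
      ∑ m, christoffel g e m j i (e (φ x)) * pdEmb e ι m (e (φ x)) B
        + secondFF e ι j i (e (φ x)) B := by
    intro i j
    have : pd j (fun z => pdEmb e ι i z B) (e (φ x)) = (pd j (pdEmb e ι i) (e (φ x))) B := by
      have h := fderiv_comp (e (φ x)) (EuclideanSpace.proj (𝕜 := ℝ) B).differentiableAt (hX i)
      rw [ContinuousLinearMap.fderiv] at h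
      exact congrArg (fun T => T (EuclideanSpace.single j 1)) h
    rw [this, hι.pd_pdEmb he hz]
    simp
  have hcongr : ψ.ambient ι a B =ᶠ[nhds x]
      fun w => ∑ i, pdEmb e ι i (e (φ w)) B • ψ.comp e a i w := by
    filter_upwards [eventually_mem_source hφ.continuous hxe] with w hw
    exact hι.ambient_eq he hw B
  rw [SpinStructure.dirac_congr hcongr,
    SpinStructure.dirac_sum_smul (c := fun i w => pdEmb e ι i (e (φ w)) B)
      (fun i => (hXB i).mdifferentiableAt.comp x (mdifferentiableAt_chart_comp he hφ hxe))
      fun i => ψ.mdifferentiableAt_comp he hφ hxa hxe i]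
  have htw : ∀ m, twistedDirac ψ g e a m x = σ.dirac a (ψ.comp e a m) x +
      ∑ α, ∑ j, ∑ k, (christoffel g e m j k (e (φ x)) * dmap σ φ e a j α x) •
        cliff α (ψ.comp e a k x) := by
    intro m
    simp only [twistedDirac, twistedConn, SpinStructure.dirac, map_add, map_sum, cliff_smul,
      Finset.sum_add_distrib]
  have hd : ∀ i α, deriveAlong (σ.frame a α) (fun w => pdEmb e ι i (e (φ w)) B) x =
      ∑ j, dmap σ φ e a j α x * (∑ m, christoffel g e m j i (e (φ x)) * pdEmb e ι m (e (φ x)) B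
        + secondFF e ι j i (e (φ x)) B) := by
    intro i α
    rw [deriveAlong_comp_chart (F := fun z => pdEmb e ι i z B) he hφ hxe (hXB i)]
    simp only [hpdB, smul_eq_mul]
  -- The Γ-part of the derivative of X_i^B is the target-connection term of the twisted Dirac
  -- operator, once i and m exchange their places as outer and inner index; the II-part is the
  -- normal term.
  simp only [htw, hd, smul_add, Finset.sum_add_distrib, add_assoc, mul_add, add_smul]
  congr 2
  · simp only [Finset.smul_sum, Finset.sum_smul, Finset.mul_sum, smul_smul]
    rw [sum_comm_outer_inner]
    refine Finset.sum_congr rfl fun m _ => Finset.sum_congr rfl fun α _ =>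
      Finset.sum_congr rfl fun j _ => Finset.sum_congr rfl fun i _ => ?_
    congr 1
    ring
  · simp only [termIISpinor, gradCliff, Finset.smul_sum, Finset.sum_smul, smul_smul]
    rw [Finset.sum_comm (s := Finset.univ (α := Fin n)) (t := Finset.univ (α := Fin n))]
    refine Finset.sum_congr rfl fun j _ => ?_
    rw [Finset.sum_comm]
    simp only [mul_comm]

end SpinorFields

/-- Clifford multiplication by a tangent vector is skew-Hermitian. -/
lemma inner_cliff (α : Fin 2) (χ χ' : Spinor) :
    ⟪χ', cliff α χ⟫_ℂ = -(starRingEnd ℂ) ⟪χ, cliff α χ'⟫_ℂ := by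
  fin_cases α <;>
  · simp [cliff, gammaMatrix, Matrix.toLpLin_apply, PiLp.inner_apply, Fin.sum_univ_two,
      dotProduct]
    ring

/-- This relabelling fixes any weight of the form s i k * s j l, and so pairs up the terms of the
contracted ∇R. -/
lemma sum_swap_pairs {κ V : Type*} [Fintype κ] [AddCommMonoid V] (f : κ → κ → κ → κ → V) :
    ∑ i, ∑ j, ∑ k, ∑ l, f i j k l = ∑ i, ∑ j, ∑ k, ∑ l, f j i l k := by
  rw [Finset.sum_comm]
  exact Finset.sum_congr rfl fun i _ => Finset.sum_congr rfl fun j _ => Finset.sum_comm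

lemma sum_comm_first_last {κ₁ κ₂ κ₃ κ₄ V : Type*} [Fintype κ₁] [Fintype κ₂] [Fintype κ₃]
    [Fintype κ₄] [AddCommMonoid V] (f : κ₁ → κ₂ → κ₃ → κ₄ → V) :
    ∑ m, ∑ i, ∑ j, ∑ k, f m i j k = ∑ i, ∑ j, ∑ k, ∑ m, f m i j k :=
  Finset.sum_comm.trans (Finset.sum_congr rfl fun _ _ => Finset.sum_comm.trans
    (Finset.sum_congr rfl fun _ _ => Finset.sum_comm))

/-! ### Matching the curvature terms; the two equivalences. -/

section Equations

variable {M : Type*} [TopologicalSpace M] [ChartedSpace (EuclideanSpace ℝ (Fin 2)) M]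
  [IsManifold (𝓡 2) ∞ M] {h : Metric 2 M} {A : Type*} {σ : SpinStructure h A}
  {n : ℕ} {N : Type*} [TopologicalSpace N] [ChartedSpace (EuclideanSpace ℝ (Fin n)) N]
  [IsManifold (𝓡 n) ∞ N] {g : Metric n N} {e : OpenPartialHomeomorph N (EuclideanSpace ℝ (Fin n))}
  {q : ℕ} {ι : N → EuclideanSpace ℝ (Fin q)} {φ : M → N} {ψ : VectorSpinor (n := n) σ φ}
  {a : A} {x : M}

omit [ChartedSpace (EuclideanSpace ℝ (Fin n)) N] [IsManifold (𝓡 n) ∞ N] in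
lemma inner_gradCliff (l : Fin n) (χ χ' : Spinor) :
    ⟪χ', gradCliff σ φ e a l x χ⟫_ℂ =
      -(starRingEnd ℂ) ⟪χ, gradCliff σ φ e a l x χ'⟫_ℂ := by
  simp only [gradCliff, inner_sum, inner_smul_right_eq_smul, map_sum, ← Finset.sum_neg_distrib]
  refine Finset.sum_congr rfl fun α _ => ?_
  rw [inner_cliff]
  simp

/-- Only the real parts of `⟨ψⁱ, ∇φˡ · ψʲ⟩` contribute to the curvature term, by the antisymmetry
of the curvature tensor. -/
lemma IsIsometricEmbedding.sum_curvUp_mul_inner (hι : IsIsometricEmbedding g ι)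
    (he : e ∈ IsManifold.maximalAtlas (𝓡 n) ∞ N) (hxe : φ x ∈ e.source) (m : Fin n) :
    (1 / 2) * ∑ l, ∑ i, ∑ j, (curvUp g e m l i j (e (φ x)) : ℂ) *
        ⟪ψ.comp e a i x, gradCliff σ φ e a l x (ψ.comp e a j x)⟫_ℂ =
      ((∑ l, ∑ i, ∑ j, (⟪ψ.comp e a i x, gradCliff σ φ e a l x (ψ.comp e a j x)⟫_ℂ).re *
        ∑ k, invMetric g e (e (φ x)) m k *
          ⟪secondFF e ι i k (e (φ x)), secondFF e ι j l (e (φ x))⟫_ℝ : ℝ) : ℂ) := by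
  set K : Fin n → Fin n → Fin n → ℝ := fun l i j => ∑ k, invMetric g e (e (φ x)) m k *
    ⟪secondFF e ι i k (e (φ x)), secondFF e ι j l (e (φ x))⟫_ℝ with hK
  set S : Fin n → Fin n → Fin n → ℂ := fun l i j =>
    ⟪ψ.comp e a i x, gradCliff σ φ e a l x (ψ.comp e a j x)⟫_ℂ with hS
  have hR : ∀ l i j, curvUp g e m l i j (e (φ x)) = K l i j - K l j i := by
    intro l i j
    simp only [hι.curvUp_eq he (e.map_source hxe), hK, mul_sub, Finset.sum_sub_distrib]
  have hskew : ∀ l i j, S l j i = -(starRingEnd ℂ) (S l i j) :=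
    fun l i j => inner_gradCliff l _ _
  push_cast
  rw [Finset.mul_sum]
  refine Finset.sum_congr rfl fun l _ => ?_
  change _ * ∑ i, ∑ j, _ * S l i j = ∑ i, ∑ j, ((S l i j).re : ℂ) * _
  -- Relabelling moves the antisymmetry of R = K_ij - K_ji onto S, leaving K_ij (S_ij - S_ji); by
  -- skewness S_ij - S_ji is S_ij plus its conjugate, twice the real part.
  have h1 : ∑ i, ∑ j, (K l j i : ℂ) * S l i j = ∑ i, ∑ j, (K l i j : ℂ) * S l j i :=
    Finset.sum_comm
  simp only [hR, Complex.ofReal_sub, sub_mul, Finset.sum_sub_distrib, h1]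
  rw [← Finset.sum_sub_distrib, Finset.mul_sum]
  refine Finset.sum_congr rfl fun i _ => ?_
  rw [← Finset.sum_sub_distrib, Finset.mul_sum]
  refine Finset.sum_congr rfl fun j _ => ?_
  rw [hskew l i j, Complex.re_eq_add_conj]
  simp only [hK]
  push_cast
  ring

lemma IsIsometricEmbedding.sum_covCurv_mul (hι : IsIsometricEmbedding g ι)
    (he : e ∈ IsManifold.maximalAtlas (𝓡 n) ∞ N) {z : EuclideanSpace ℝ (Fin n)}
    (hz : z ∈ e.target) (p : Fin n) (s : Fin n → Fin n → ℂ) :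
    ∑ i, ∑ j, ∑ k, ∑ l, (covCurv g e p i j k l z : ℂ) * s i k * s j l =
      2 * ∑ i, ∑ j, ∑ k, ∑ l,
        ((⟪covSecondFF g e ι p i k z, secondFF e ι j l z⟫_ℝ
          - ⟪covSecondFF g e ι p i l z, secondFF e ι j k z⟫_ℝ : ℝ) : ℂ) * s i k * s j l := by
  rw [two_mul]
  nth_rewrite 2 [sum_swap_pairs]
  simp only [← Finset.sum_add_distrib, hι.covCurv_eq he hz]
  refine Finset.sum_congr rfl fun i _ => Finset.sum_congr rfl fun j _ =>
    Finset.sum_congr rfl fun k _ => Finset.sum_congr rfl fun l _ => ?_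
  push_cast
  ring

/-- Collects the coefficient of X_m in the P-term, in the form that `sum_curvUp_mul_inner` produces
from the curvature term. -/
lemma termP_apply (B : Fin q) :
    termP ψ g e ι a x B = ∑ m, pdEmb e ι m (e (φ x)) B *
      ∑ l, ∑ i, ∑ j, (⟪ψ.comp e a i x, gradCliff σ φ e a l x (ψ.comp e a j x)⟫_ℂ).re *
        ∑ k, invMetric g e (e (φ x)) m k *
          ⟪secondFF e ι i k (e (φ x)), secondFF e ι j l (e (φ x))⟫_ℝ := by
  simp only [Finset.mul_sum]
  rw [sum_comm_first_last]
  simp only [termP, shapeOp, WithLp.ofLp_sum, WithLp.ofLp_smul, Finset.sum_apply, Pi.smul_apply,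
    smul_eq_mul]
  refine Finset.sum_congr rfl fun l _ => Finset.sum_congr rfl fun i _ =>
    Finset.sum_congr rfl fun j _ => ?_
  simp only [Finset.mul_sum, Finset.sum_mul]
  exact Finset.sum_congr rfl fun m _ => Finset.sum_congr rfl fun k _ => by ring

/-- The intrinsic and extrinsic equations for the map are equivalent. -/
lemma IsIsometricEmbedding.eulerLagrangeMap_iff (hι : IsIsometricEmbedding g ι)
    (he : e ∈ IsManifold.maximalAtlas (𝓡 n) ∞ N)
    (hφ : ContMDiff (𝓡 2) (𝓡 n) ∞ φ) (hxa : x ∈ σ.U a) (hxe : φ x ∈ e.source) :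
    EulerLagrangeMap ψ g e a x ↔ ExtrinsicMap ψ g e ι a x := by
  have hz := e.map_source hxe
  rw [EulerLagrangeMap, ← hι.sum_pdEmb_smul_eq_iff he hz]
  refine forall_congr' fun B => ?_
  have h1 : ∀ m, (1 / 12 : ℂ) * ∑ p, ∑ i, ∑ j, ∑ k, ∑ l,
        (invMetric g e (e (φ x)) m p : ℂ) * (covCurv g e p i j k l (e (φ x)) : ℂ) *
        ⟪ψ.comp e a i x, ψ.comp e a k x⟫_ℂ * ⟪ψ.comp e a j x, ψ.comp e a l x⟫_ℂ =
      (1 / 6) * ∑ p, (invMetric g e (e (φ x)) m p : ℂ) * ∑ i, ∑ j, ∑ k, ∑ l,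
      ((⟪covSecondFF g e ι p i k (e (φ x)), secondFF e ι j l (e (φ x))⟫_ℝ
        - ⟪covSecondFF g e ι p i l (e (φ x)), secondFF e ι j k (e (φ x))⟫_ℝ : ℝ) : ℂ) *
      ⟪ψ.comp e a i x, ψ.comp e a k x⟫_ℂ * ⟪ψ.comp e a j x, ψ.comp e a l x⟫_ℂ := by
    intro m
    rw [Finset.mul_sum, Finset.mul_sum]
    refine Finset.sum_congr rfl fun p _ => ?_
    have h2 := hι.sum_covCurv_mul he hz p
      fun i k => ⟪ψ.comp e a i x, ψ.comp e a k x⟫_ℂ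
    simp only [mul_assoc, ← Finset.mul_sum] at h2 ⊢
    rw [h2]
    ring
  have h3 : (-σ.laplacian a (fun w => ι (φ w)) x) B =
      ∑ m, pdEmb e ι m (e (φ x)) B * tension σ φ g e a m x + termII σ φ e ι a x B := by
    rw [hι.neg_laplacian_comp he hφ hxa hxe]
    simp [mul_comm]
  have h4 : termG ψ g e ι a B x = ∑ m, (pdEmb e ι m (e (φ x)) B : ℂ) *
      ((1 / 6) * ∑ p, (invMetric g e (e (φ x)) m p : ℂ) * ∑ i, ∑ j, ∑ k, ∑ l,
      ((⟪covSecondFF g e ι p i k (e (φ x)), secondFF e ι j l (e (φ x))⟫_ℝ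
        - ⟪covSecondFF g e ι p i l (e (φ x)), secondFF e ι j k (e (φ x))⟫_ℝ : ℝ) : ℂ) *
      ⟪ψ.comp e a i x, ψ.comp e a k x⟫_ℂ * ⟪ψ.comp e a j x, ψ.comp e a l x⟫_ℂ) := by
    rw [termG, Finset.mul_sum]
    refine Finset.sum_congr rfl fun m _ => ?_
    rw [mul_left_comm, Finset.mul_sum _ _ (pdEmb e ι m (e (φ x)) B : ℂ)]
    congr 1
    refine Finset.sum_congr rfl fun p _ => ?_
    push_cast
    ring
  simp only [h1, hι.sum_curvUp_mul_inner he hxe, h3, h4, termP_apply, Complex.real_smul, mul_sub,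
    Finset.sum_sub_distrib]
  -- II(dφ, dφ) stands on both sides and cancels, which leaves the identity of tangential
  -- combinations.
  rw [Complex.ofReal_add, Complex.ofReal_sum, Complex.ofReal_sum, add_comm, add_sub_assoc,
    add_right_inj]
  simp only [Complex.ofReal_mul]

/-- The inverse metric in the shape operator raises the free index of the Gauss equation, so the two
agree coefficient by coefficient without any symmetrization against the spinors. -/
lemma IsIsometricEmbedding.shapeOp_sub_shapeOp (hι : IsIsometricEmbedding g ι)
    (he : e ∈ IsManifold.maximalAtlas (𝓡 n) ∞ N) {z : EuclideanSpace ℝ (Fin n)}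
    (hz : z ∈ e.target) (j k l : Fin n) :
    shapeOp g e ι (secondFF e ι l j z) k z - shapeOp g e ι (secondFF e ι k j z) l z =
      ∑ m, curvUp g e m j k l z • pdEmb e ι m z := by
  simp only [shapeOp, ← Finset.sum_sub_distrib, ← sub_smul, hι.curvUp_eq he hz, mul_sub]

/-- The intrinsic and extrinsic equations for the spinor are equivalent. -/
lemma IsIsometricEmbedding.eulerLagrangeSpinor_iff (hι : IsIsometricEmbedding g ι)
    (he : e ∈ IsManifold.maximalAtlas (𝓡 n) ∞ N)
    (hφ : ContMDiff (𝓡 2) (𝓡 n) ∞ φ) (hxa : x ∈ σ.U a) (hxe : φ x ∈ e.source) :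
    EulerLagrangeSpinor ψ g e a x ↔ ExtrinsicSpinor ψ g e ι a x := by
  have hz := e.map_source hxe
  rw [EulerLagrangeSpinor, ← hι.sum_pdEmb_smul_eq_iff he hz]
  refine forall_congr' fun B => ?_
  rw [hι.dirac_ambient he hφ hxa hxe, add_comm, add_right_inj]
  suffices h : termF ψ g e ι a B x = ∑ m, pdEmb e ι m (e (φ x)) B •
      ((1 / 3 : ℂ) • ∑ j, ∑ k, ∑ l, ((curvUp g e m j k l (e (φ x)) : ℂ) *
        ⟪ψ.comp e a j x, ψ.comp e a l x⟫_ℂ) • ψ.comp e a k x) by rw [h]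
  simp only [termF, Finset.smul_sum]
  rw [sum_comm_first_last]
  refine Finset.sum_congr rfl fun j _ => Finset.sum_congr rfl fun k _ =>
    Finset.sum_congr rfl fun l _ => ?_
  have h : (shapeOp g e ι (secondFF e ι l j (e (φ x))) k (e (φ x))
      - shapeOp g e ι (secondFF e ι k j (e (φ x))) l (e (φ x))) B =
      ∑ m, curvUp g e m j k l (e (φ x)) * pdEmb e ι m (e (φ x)) B := by
    rw [hι.shapeOp_sub_shapeOp he hz]
    simp
  rw [h, Complex.ofReal_sum, Finset.sum_mul, Finset.sum_smul, Finset.smul_sum]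
  refine Finset.sum_congr rfl fun m _ => ?_
  simp only [← Complex.coe_smul, smul_smul]
  congr 1
  push_cast
  ring

end Equations

end DiracHarmonic

theorem mainTheorem7
    {M : Type*} [TopologicalSpace M] [ChartedSpace (EuclideanSpace ℝ (Fin 2)) M]
    [IsManifold (𝓡 2) ∞ M] [CompactSpace M] [T2Space M]
    (h : DiracHarmonic.Metric 2 M) {A : Type*} (σ : DiracHarmonic.SpinStructure h A)
    {n : ℕ} {N : Type*} [TopologicalSpace N] [ChartedSpace (EuclideanSpace ℝ (Fin n)) N]
    [IsManifold (𝓡 n) ∞ N] [CompactSpace N] [T2Space N] (g : DiracHarmonic.Metric n N)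
    {q : ℕ} (ι : N → EuclideanSpace ℝ (Fin q)) (hι : DiracHarmonic.IsIsometricEmbedding g ι)
    (φ : M → N) (hφ : ContMDiff (𝓡 2) (𝓡 n) ∞ φ)
    (ψ : DiracHarmonic.VectorSpinor (n := n) σ φ)
    (a : A) (e : OpenPartialHomeomorph N (EuclideanSpace ℝ (Fin n)))
    (he : e ∈ IsManifold.maximalAtlas (𝓡 n) ∞ N)
    (x : M) (hxa : x ∈ σ.U a) (hxe : φ x ∈ e.source) :
    (DiracHarmonic.EulerLagrangeMap ψ g e a x ↔
      DiracHarmonic.ExtrinsicMap ψ g e ι a x) ∧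
    (DiracHarmonic.EulerLagrangeSpinor ψ g e a x ↔
      DiracHarmonic.ExtrinsicSpinor ψ g e ι a x) := by
  exact ⟨hι.eulerLagrangeMap_iff he hφ hxa hxe, hι.eulerLagrangeSpinor_iff he hφ hxa hxe⟩
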